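/- **Setting.** Let $V,W:\mathbb R^d\to\mathbb R$ be differentiable and let $\nabla W$ be $\beta_W$-Lipschitz, i.e. $\|\nabla W(x)-\nabla W(y)\|\le\beta_W\|x-y\|$ for all $x,y$. For $N\ge 2$ let $\mu^{1:N}$ be the probability measure on $\mathbb R^{d\times N}$ with density $$\mu^{1:N}(x^{1:N})\propto\exp\Bigl(-\sum_{i=1}^N V(x^i)-\frac1{2(N-1)}\sum_{i\in[N]}\sum_{j\in[N]\setminus\{i\}}W(x^i-x^j)\Bigr).$$ For $1\le k\le N$ let $\mu^{[k]}$ be the law of the first $k$ particles, and for $1\le k\le N-1$, $1\le \ell\le N-k$ and $x^{[k]}\in\mathbb R^{d\times k}$ let $\mu^{k+1:k+\ell\mid[k]}(\cdot\mid x^{[k]})$ be the conditional law of particles $k+1,\dots,k+\ell$ given that the first $k$ particles are at $x^{[k]}$, defined for every $x^{[k]}$ by normalizing the density above at fixed $x^{[k]}$ and marginalizing; write $\mu^{k+1\mid[k]}$ when $\ell=1$. A probability measure $\nu$ on a Euclidean space satisfies the log-Sobolev inequality (LSI) with constant $C$ if, for all smooth compactly supported $f$, $$\mathbb E_\nu\Bigl[f^2\log\frac{f^2}{\mathbb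 E_\nu f^2}\Bigr]\le 2C\,\mathbb E_\nu\|\nabla f\|^2 .$$ **Isoperimetry.** Let $\bar C_{\mathsf{LSI}}>0$ and assume that the following measures are well-defined probability measures satisfying LSI with the constant $\bar C_{\mathsf{LSI}}$: all conditional laws $\mu^{k+1:k+\ell\mid[k]}(\cdot\mid x^{[k]})$ with $1\le k\le N-1$, $1\le\ell\le N-k$, $x^{[k]}\in\mathbb R^{d\times k}$; all $\mu^{[k]}$ with $1\le k\le N$; and a probability measure $\pi$ on $\mathbb R^d$ that minimizes $$\mathcal E(\mu)=\int V\,\mathrm d\mu+\frac12\iint W(x-y)\,\mathrm d\mu(x)\,\mathrm d\mu(y)+\int\log\mu\,\mathrm d\mu$$ over the absolutely continuous probability measures for which all three terms are finite. **Statement (Lipschitz recursion).** There are absolute constants $c,\delta,K>0$ (independent of $d,N,k,V,W,\beta_W,\bar C_{\mathsf{LSI}},\pi$) such that, in the above setting, if $$\beta_W\bar C_{\mathsf{LSI}}\le c,\qquad N\ge100,\qquad 1\le k<N,\qquad k\le\delta N,$$ then for all $x^{[k]},\bar x^{[k]}\in\mathbb R^{d\times k}$ the distances $W_2(\mu^{k+1\mid[k]}(\cdot\mid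 x^{[k]}),\pi)$ and $W_2(\mu^{k+1\mid[k]}(\cdot\mid\bar x^{[k]}),\pi)$ are finite and $$\Bigl|W_2\bigl(\mu^{k+1\mid[k]}(\cdot\mid x^{[k]}),\pi\bigr)-W_2\bigl(\mu^{k+1\mid[k]}(\cdot\mid\bar x^{[k]}),\pi\bigr)\Bigr|\le K\,\frac{\sqrt k\,\|x^{[k]}-\bar x^{[k]}\|}{N},$$ where $W_2$ is the 2-Wasserstein distance for the Euclidean norm and $\|\cdot\|$ is the Euclidean norm on $\mathbb R^{d\times k}$. -/

import Mathlib

open MeasureTheory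
open scoped ENNReal ContDiff

noncomputable section

namespace PropChaos

/-- The state space `ℝ^d` of one particle, with the Euclidean norm. -/
abbrev Pt (d : ℕ) : Type := EuclideanSpace ℝ (Fin d)

/-- The space `ℝ^{d × n}` of configurations of `n` particles, with the Euclidean (Frobenius) norm
and Lebesgue measure. -/
abbrev Config (d n : ℕ) : Type := PiLp 2 (fun _ : Fin n => Pt d)

/-- The 2-Wasserstein distance
`W₂(μ, ν) = (inf_γ ∫ ‖x - y‖² dγ(x, y))^{1/2}`, the infimum running over all couplings of `μ` and
`ν`, as an extended nonnegative real. -/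
def W2 {X : Type*} [MeasurableSpace X] [PseudoEMetricSpace X] (μ ν : Measure X) : ℝ≥0∞ :=
  (⨅ (γ : Measure (X × X)) (_ : γ.map Prod.fst = μ ∧ γ.map Prod.snd = ν),
    ∫⁻ p, edist p.1 p.2 ^ 2 ∂γ) ^ (1 / 2 : ℝ)

/-- The entropy functional `ent_μ(g) = E_μ[g log (g / E_μ g)]`, for `g ≥ 0`. -/
def ent {X : Type*} [MeasurableSpace X] (μ : Measure X) (g : X → ℝ) : ℝ :=
  ∫ x, g x * Real.log (g x / ∫ y, g y ∂μ) ∂μ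

/-- The probability measure `μ` satisfies the log-Sobolev inequality with constant `C`:
`ent_μ(f²) ≤ 2 C E_μ ‖∇f‖²` for every smooth compactly supported `f`. -/
structure LogSobolev {X : Type*} [NormedAddCommGroup X] [InnerProductSpace ℝ X] [CompleteSpace X]
    [MeasurableSpace X] (μ : Measure X) (C : ℝ) : Prop where
  isProbabilityMeasure : IsProbabilityMeasure μ
  ineq : ∀ f : X → ℝ, ContDiff ℝ ∞ f → HasCompactSupport f →
    ent μ (fun x => f x ^ 2) ≤ 2 * C * ∫ x, ‖gradient f x‖ ^ 2 ∂μ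

/-- The probability measure on `X` with Lebesgue density proportional to `exp (-H)`.
It is the zero measure when `exp (-H)` has infinite integral. -/
def gibbs {X : Type*} [MeasureSpace X] (H : X → ℝ) : Measure X :=
  (∫⁻ x : X, ENNReal.ofReal (Real.exp (-H x)))⁻¹ •
    (volume : Measure X).withDensity (fun x => ENNReal.ofReal (Real.exp (-H x)))

section Particles

variable {d : ℕ} (V W : Pt d → ℝ)

/-- The `N`-particle Hamiltonian
`∑ i, V (x i) + 1 / (2 (N - 1)) * ∑ i, ∑ j ≠ i, W (x i - x j)`. -/
def hamiltonian (N : ℕ) (x : Fin N → Pt d) : ℝ :=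
  ∑ i, V (x i) + 1 / (2 * ((N : ℝ) - 1)) * ∑ i, ∑ j ∈ Finset.univ.erase i, W (x i - x j)

/-- The stationary measure `μ^{1:N} ∝ exp (-hamiltonian)` of the `N`-particle system. -/
def jointLaw (N : ℕ) : Measure (Config d N) :=
  gibbs (fun x => hamiltonian V W N x)

/-- The first `m` particles of an `n`-particle configuration. -/
def firstParticles {n m : ℕ} (h : m ≤ n) (x : Config d n) : Config d m :=
  WithLp.toLp 2 (fun i => x (Fin.castLE h i))

/-- The law `μ^{[k]}` of the first `k` out of `N` particles. -/
def marginalLaw (N k : ℕ) (h : k ≤ N) : Measure (Config d k) :=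
  (jointLaw V W N).map (firstParticles h)

/-- The `N`-particle configuration whose first `k` particles are `x` and whose last `N - k`
particles are `y`. -/
def glue {N k : ℕ} (x : Config d k) (y : Config d (N - k)) : Fin N → Pt d :=
  fun i => if h : i.1 < k then x ⟨i.1, h⟩ else y ⟨i.1 - k, by omega⟩

/-- The conditional law `μ^{k+1:k+l | [k]}(· | x)` of particles `k+1, …, k+l` given that the first
`k` particles are at `x`: the conditional law of all the remaining `N - k` particles has density
proportional to `y ↦ exp (-hamiltonian (x, y))`, and one takes its marginal on its first `l`
particles. -/
def condLaw (N k l : ℕ) (h : l ≤ N - k) (x : Config d k) : Measure (Config d l) :=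
  (gibbs (fun y : Config d (N - k) => hamiltonian V W N (glue x y))).map (firstParticles h)

/-- The conditional law `μ^{k+1 | [k]}(· | x)` of particle `k+1`, as a measure on `ℝ^d`. -/
def nextLaw (N k : ℕ) (h : k < N) (x : Config d k) : Measure (Pt d) :=
  (condLaw V W N k 1 (Nat.sub_pos_of_lt h) x).map (fun z => z 0)

/-- Absolutely continuous probability measures for which each term of the mean-field energy is
finite. -/
structure FiniteEnergy (μ : Measure (Pt d)) : Prop where
  isProbabilityMeasure : IsProbabilityMeasure μ
  absolutelyContinuous : μ ≪ volume
  integrable_confinement : Integrable V μ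
  integrable_interaction : Integrable (fun p : Pt d × Pt d => W (p.1 - p.2)) (μ.prod μ)
  integrable_log : Integrable (fun x => Real.log (μ.rnDeriv volume x).toReal) μ

/-- The mean-field energy `∫ V dμ + (1/2) ∬ W(x - y) dμ(x) dμ(y) + ∫ log μ dμ`. -/
def meanFieldEnergy (μ : Measure (Pt d)) : ℝ :=
  ∫ x, V x ∂μ + 1 / 2 * ∫ p : Pt d × Pt d, W (p.1 - p.2) ∂(μ.prod μ)
    + ∫ x, Real.log (μ.rnDeriv volume x).toReal ∂μ

/-- `π` is a minimizer of the mean-field energy. -/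
def IsMeanFieldMinimizer (π : Measure (Pt d)) : Prop :=
  FiniteEnergy V W π ∧
    ∀ μ : Measure (Pt d), FiniteEnergy V W μ → meanFieldEnergy V W π ≤ meanFieldEnergy V W μ

/-- The interaction potential `W` is differentiable with `β`-Lipschitz gradient. -/
def IsSmoothPotential (β : ℝ) : Prop :=
  Differentiable ℝ W ∧ ∀ x y, ‖gradient W x - gradient W y‖ ≤ β * ‖x - y‖

/-- Strong isoperimetry with constant `C`: log-Sobolev inequalities for all conditional laws,
uniformly in the conditioning, for all marginal laws and for the minimizer `π` of the mean-field
energy. -/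
structure StrongIsoperimetry (N : ℕ) (C : ℝ) (π : Measure (Pt d)) : Prop where
  conditional : ∀ k l : ℕ, 1 ≤ k → k ≤ N - 1 → 1 ≤ l → ∀ h : l ≤ N - k,
    ∀ x : Config d k, LogSobolev (condLaw V W N k l h x) C
  isMinimizer : IsMeanFieldMinimizer V W π
  meanField : LogSobolev π C
  marginal : ∀ k : ℕ, 1 ≤ k → ∀ h : k ≤ N, LogSobolev (marginalLaw V W N k h) C

end Particles

end PropChaos

end

noncomputable section

namespace PropChaos

open ProbabilityTheory

/-! Moving the first particles from `x` to `x'` tilts the law of the `n = N - k` remaining ones by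
`exp u`. Up to a constant, `u` is a sum of one-particle functions (`forceGap`), each Lipschitz with
constant `G = β √k ‖x - x'‖ / (N - 1)`, so `u` is `√n G`-Lipschitz. For a one-particle test function
`f` put `Φ y = ∑ j, f (y j)`. By exchangeability the change of the mean of `Φ` is `n` times the
change of the mean of `f` under the next-particle law, while the mean of `‖∇Φ‖²` is at most `n
E‖∇f‖²`. The change of the mean of `Φ` is a covariance with the tilting density, and the Poincaré
inequality for both factors bounds it by `4C · √n G · √(n E‖∇f‖²)`. The factors `√n` cancel the `n`
on the left, leaving `4CG √(E‖∇f‖²)`. Testing a single coordinate instead of the sum would lose a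
factor `√n`.

Such an `H⁻¹` bound with constant `D` gives `W₂ ≤ 3D` (`W2_le_of_weak_bound`). After discretization,
finite Kantorovich duality leaves a bound on dual pairs to prove. A dual pair is dominated by a
smooth semiconcave `f`, whose infimal convolution with `‖·‖²` gains `‖∇f‖²/8`; this gain absorbs the
error `D √(E‖∇f‖²)` and leaves `2D²`.

The tilting density is controlled in `L²` only for `‖x - x'‖` small, depending on `x`, through an
exponential moment supplied by the log-Sobolev inequality. The resulting Lipschitz constant `12 β C
√k / (N - 1)` is uniform, so the triangle inequality for `W₂` and a continuity argument along the
segment from `x'` to `x` make the estimate global (`abs_sub_le_of_locally`). -/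

/-- Gluing of two couplings along their common marginal. -/
theorem exists_gluing {X : Type*} [MeasurableSpace X] [StandardBorelSpace X] [Nonempty X] (γ₁ γ₂ : Measure (X × X))
    [IsProbabilityMeasure γ₁] [IsProbabilityMeasure γ₂]
    (h : γ₁.map Prod.snd = γ₂.map Prod.fst) :
    ∃ Γ : Measure (X × X × X), Γ.map (fun p => (p.2.1, p.1)) = γ₁ ∧
      Γ.map (fun p => (p.1, p.2.2)) = γ₂ := by
  set γ : Measure (X × X) := γ₁.map Prod.swap with hγ
  have : IsProbabilityMeasure γ := Measure.isProbabilityMeasure_map measurable_swap.aemeasurable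
  have hfst : γ.fst = γ₂.fst := by
    rw [Measure.fst, Measure.fst, hγ, Measure.map_map measurable_fst measurable_swap, ← h]
    rfl
  -- Given the shared coordinate, the two outer ones are independent; the order is (shared, first,
  -- last).
  refine ⟨γ.fst ⊗ₘ (γ.condKernel ×ₖ γ₂.condKernel), ?_, ?_⟩
  · have h1 : (γ.fst ⊗ₘ (γ.condKernel ×ₖ γ₂.condKernel)).map
        (Prod.map id Prod.fst) = γ := by
      rw [← Measure.compProd_map measurable_fst, ← Kernel.fst_eq, Kernel.fst_prod,
        Measure.disintegrate]
    have h2 : γ.map Prod.swap = γ₁ := by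
      rw [hγ, Measure.map_map measurable_swap measurable_swap]; simp
    have h3 : (γ.fst ⊗ₘ (γ.condKernel ×ₖ γ₂.condKernel)).map (fun p => (p.2.1, p.1))
        = ((γ.fst ⊗ₘ (γ.condKernel ×ₖ γ₂.condKernel)).map (Prod.map id Prod.fst)).map
          Prod.swap := by
      rw [Measure.map_map measurable_swap (by fun_prop)]
      rfl
    rw [h3, h1, h2]
  · have h1 : (γ.fst ⊗ₘ (γ.condKernel ×ₖ γ₂.condKernel)).map
        (Prod.map id Prod.snd) = γ₂ := by
      rw [← Measure.compProd_map measurable_snd, ← Kernel.snd_eq, Kernel.snd_prod, hfst,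
        Measure.disintegrate]
    exact h1

/-! ### Elementary properties of the Wasserstein distance. -/

section Wasserstein

variable {X : Type*} [MeasurableSpace X] [PseudoEMetricSpace X]

/-- With the square root inside the infimum, each coupling contributes an `L²` norm, to which
Minkowski's inequality applies. -/
theorem W2_eq_iInf (μ ν : Measure X) :
    W2 μ ν = ⨅ γ : {γ : Measure (X × X) // γ.map Prod.fst = μ ∧ γ.map Prod.snd = ν},
      (∫⁻ p, edist p.1 p.2 ^ (2 : ℝ) ∂γ.1) ^ (1 / 2 : ℝ) := by
  have h := (ENNReal.orderIsoRpow (1 / 2 : ℝ) (by norm_num)).map_iInf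
    (fun γ : {γ : Measure (X × X) // γ.map Prod.fst = μ ∧ γ.map Prod.snd = ν} =>
      ∫⁻ p, edist p.1 p.2 ^ (2 : ℝ) ∂γ.1)
  simp only [ENNReal.orderIsoRpow_apply] at h
  rw [← h, W2, iInf_subtype]
  simp only [ENNReal.rpow_ofNat]

theorem W2_le_of_coupling {μ ν : Measure X} (γ : Measure (X × X)) (h₁ : γ.map Prod.fst = μ)
    (h₂ : γ.map Prod.snd = ν) : W2 μ ν ≤ (∫⁻ p, edist p.1 p.2 ^ (2 : ℝ) ∂γ) ^ (1 / 2 : ℝ) := by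
  rw [W2_eq_iInf]
  exact iInf_le (fun γ : {γ : Measure (X × X) // γ.map Prod.fst = μ ∧ γ.map Prod.snd = ν} =>
    (∫⁻ p, edist p.1 p.2 ^ (2 : ℝ) ∂γ.1) ^ (1 / 2 : ℝ)) ⟨γ, h₁, h₂⟩

theorem W2_comm [OpensMeasurableSpace X] [SecondCountableTopology X] (μ ν : Measure X) :
    W2 μ ν = W2 ν μ := by
  have key : ∀ μ ν : Measure X, W2 μ ν ≤ W2 ν μ := by
    intro μ ν
    rw [W2_eq_iInf ν μ]
    refine le_iInf fun γ => ?_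
    refine (W2_le_of_coupling (γ.1.map Prod.swap) ?_ ?_).trans ?_
    · rw [Measure.map_map measurable_fst measurable_swap]; exact γ.2.2
    · rw [Measure.map_map measurable_snd measurable_swap]; exact γ.2.1
    · rw [lintegral_map (by fun_prop) measurable_swap]
      simp [edist_comm]
  exact le_antisymm (key _ _) (key _ _)

theorem W2_triangle [OpensMeasurableSpace X] [SecondCountableTopology X] [StandardBorelSpace X]
    [Nonempty X] (μ ν ρ : Measure X) [IsProbabilityMeasure μ] [IsProbabilityMeasure ν] :
    W2 μ ρ ≤ W2 μ ν + W2 ν ρ := by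
  rw [W2_eq_iInf μ ν, W2_eq_iInf ν ρ]
  refine ENNReal.le_iInf_add_iInf fun γ₁ γ₂ => ?_
  obtain ⟨γ₁, h₁, h₁'⟩ := γ₁
  obtain ⟨γ₂, h₂, h₂'⟩ := γ₂
  have : IsProbabilityMeasure γ₁ := by
    rw [← Measure.isProbabilityMeasure_map_iff measurable_fst.aemeasurable, h₁]; infer_instance
  have : IsProbabilityMeasure γ₂ := by
    rw [← Measure.isProbabilityMeasure_map_iff measurable_fst.aemeasurable, h₂]; infer_instance
  obtain ⟨Γ, hΓ₁, hΓ₂⟩ := exists_gluing γ₁ γ₂ (h₁'.trans h₂.symm)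
  have e1 : ∫⁻ p, edist p.1 p.2 ^ (2 : ℝ) ∂γ₁ = ∫⁻ p, edist p.2.1 p.1 ^ (2 : ℝ) ∂Γ := by
    rw [← hΓ₁, lintegral_map (by fun_prop) (by fun_prop)]
  have e2 : ∫⁻ p, edist p.1 p.2 ^ (2 : ℝ) ∂γ₂ = ∫⁻ p, edist p.1 p.2.2 ^ (2 : ℝ) ∂Γ := by
    rw [← hΓ₂, lintegral_map (by fun_prop) (by fun_prop)]
  simp only [e1, e2]
  refine (W2_le_of_coupling (Γ.map (fun p => (p.2.1, p.2.2))) ?_ ?_).trans ?_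
  · rw [Measure.map_map measurable_fst (by fun_prop), ← h₁, ← hΓ₁,
      Measure.map_map measurable_fst (by fun_prop)]
    rfl
  · rw [Measure.map_map measurable_snd (by fun_prop), ← h₂', ← hΓ₂,
      Measure.map_map measurable_snd (by fun_prop)]
    rfl
  · rw [lintegral_map (by fun_prop) (by fun_prop)]
    refine le_trans ?_ (ENNReal.lintegral_Lp_add_le (μ := Γ) (by fun_prop) (by fun_prop)
      (by norm_num : (1 : ℝ) ≤ 2))
    gcongr with p
    exact edist_triangle _ _ _

end Wasserstein

/-- The product coupling already has finite cost. -/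
theorem W2_ne_top {X : Type*} [NormedAddCommGroup X] [MeasurableSpace X] [OpensMeasurableSpace X]
    [SecondCountableTopology X] (μ ν : Measure X) [IsProbabilityMeasure μ] [IsProbabilityMeasure ν]
    (hμ : ∫⁻ x, ‖x‖ₑ ^ (2 : ℝ) ∂μ ≠ ⊤) (hν : ∫⁻ x, ‖x‖ₑ ^ (2 : ℝ) ∂ν ≠ ⊤) : W2 μ ν ≠ ⊤ := by
  refine ne_top_of_le_ne_top ?_ (W2_le_of_coupling (μ.prod ν) (by simp) (by simp))
  refine ENNReal.rpow_ne_top_of_nonneg (by norm_num) ?_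
  have e1 : ∫⁻ p : X × X, ‖p.1‖ₑ ^ (2 : ℝ) ∂(μ.prod ν) = ∫⁻ x, ‖x‖ₑ ^ (2 : ℝ) ∂μ := by
    rw [lintegral_prod _ (by fun_prop)]; simp
  have e2 : ∫⁻ p : X × X, ‖p.2‖ₑ ^ (2 : ℝ) ∂(μ.prod ν) = ∫⁻ x, ‖x‖ₑ ^ (2 : ℝ) ∂ν := by
    rw [lintegral_prod _ (by fun_prop)]; simp
  refine ne_top_of_le_ne_top (b := 2 * ∫⁻ p : X × X, ‖p.1‖ₑ ^ (2 : ℝ) ∂(μ.prod ν)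
    + 2 * ∫⁻ p : X × X, ‖p.2‖ₑ ^ (2 : ℝ) ∂(μ.prod ν)) ?_ ?_
  · rw [e1, e2]
    exact ENNReal.add_ne_top.2 ⟨ENNReal.mul_ne_top (by simp) hμ, ENNReal.mul_ne_top (by simp) hν⟩
  · rw [← lintegral_const_mul _ (by fun_prop), ← lintegral_const_mul _ (by fun_prop),
      ← lintegral_add_left (by fun_prop)]
    refine lintegral_mono fun p => ?_
    have h1 : edist p.1 p.2 ≤ ‖p.1‖ₑ + ‖p.2‖ₑ := by
      rw [edist_eq_enorm_sub]; exact enorm_sub_le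
    calc edist p.1 p.2 ^ (2 : ℝ) ≤ (‖p.1‖ₑ + ‖p.2‖ₑ) ^ (2 : ℝ) := by gcongr
      _ ≤ 2 ^ ((2 : ℝ) - 1) * (‖p.1‖ₑ ^ (2 : ℝ) + ‖p.2‖ₑ ^ (2 : ℝ)) :=
        ENNReal.rpow_add_le_mul_rpow_add_rpow _ _ (by norm_num)
      _ = _ := by norm_num [mul_add]

/-! ### Kantorovich duality on a finite set. -/

/-- Finite Kantorovich duality. -/
theorem exists_discrete_coupling {ι : Type*} [Fintype ι] (c : ι → ι → ℝ)
    (a b : ι → ℝ) (ha : ∑ i, a i = 1) (B : ℝ)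
    (h : ∀ φ ψ : ι → ℝ, (∀ i j, φ i + ψ j ≤ c i j) → ∑ i, φ i * a i + ∑ j, ψ j * b j ≤ B) :
    ∃ g : ι → ι → ℝ, (∀ i j, 0 ≤ g i j) ∧ (∀ i, ∑ j, g i j = a i) ∧ (∀ j, ∑ i, g i j = b j) ∧
      ∑ i, ∑ j, g i j * c i j ≤ B := by
  classical
  let T : (ι × ι → ℝ) →ₗ[ℝ] (ι → ℝ) × (ι → ℝ) × ℝ :=
    { toFun := fun g => (fun i => ∑ j, g (i, j), fun j => ∑ i, g (i, j),
        ∑ i, ∑ j, g (i, j) * c i j)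
      map_add' := by
        intro x y
        ext <;> simp [Finset.sum_add_distrib, add_mul]
      map_smul' := by
        intro r x
        ext <;> simp [Finset.mul_sum, mul_assoc] }
  have hTc : Continuous T := LinearMap.continuous_of_finiteDimensional T
  -- `S` collects (row sums, column sums, cost) over all plans of mass one, `R` the admissible
  -- values. A common point is the wanted plan; if there is none, a separating functional yields a
  -- dual pair contradicting `h`.
  set S : Set ((ι → ℝ) × (ι → ℝ) × ℝ) := T '' stdSimplex ℝ (ι × ι)
  set R : Set ((ι → ℝ) × (ι → ℝ) × ℝ) := {p | p.1 = a ∧ p.2.1 = b ∧ p.2.2 ≤ B}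
  by_cases hdisj : Disjoint S R
  · exfalso
    have hSc : IsCompact S := (isCompact_stdSimplex ℝ (ι × ι)).image hTc
    have hSv : Convex ℝ S := (convex_stdSimplex ℝ (ι × ι)).linear_image T
    have hRc : IsClosed R := by
      refine (isClosed_eq continuous_fst continuous_const).inter
        ((isClosed_eq (continuous_fst.comp continuous_snd) continuous_const).inter
        (isClosed_le (continuous_snd.comp continuous_snd) continuous_const))
    have hRv : Convex ℝ R := by
      rintro x ⟨hx1, hx2, hx3⟩ y ⟨hy1, hy2, hy3⟩ s t hs ht hst
      refine ⟨?_, ?_, ?_⟩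
      · simp only [Prod.fst_add, Prod.smul_fst, hx1, hy1, ← add_smul, hst, one_smul]
      · simp only [Prod.fst_add, Prod.smul_fst, Prod.snd_add, Prod.smul_snd, hx2, hy2,
          ← add_smul, hst, one_smul]
      · simp only [Prod.snd_add, Prod.smul_snd, smul_eq_mul]
        calc s * x.2.2 + t * y.2.2 ≤ s * B + t * B := by gcongr
          _ = B := by rw [← add_mul, hst, one_mul]
    obtain ⟨F, u, v, hu, huv, hv⟩ := geometric_hahn_banach_compact_closed hSv hSc hRv hRc hdisj
    let φ : ι → ℝ := fun i => F (Pi.single i 1, 0, 0)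
    let ψ : ι → ℝ := fun i => F (0, Pi.single i 1, 0)
    let l : ℝ := F (0, 0, 1)
    have hF : ∀ (x y : ι → ℝ) (t : ℝ),
        F (x, y, t) = ∑ i, φ i * x i + ∑ j, ψ j * y j + l * t := by
      intro x y t
      have e : ((x, y, t) : (ι → ℝ) × (ι → ℝ) × ℝ) = ∑ i, x i • ((Pi.single i 1, 0, 0) : (ι → ℝ) × (ι → ℝ) × ℝ)
          + ∑ j, y j • ((0, Pi.single j 1, 0) : (ι → ℝ) × (ι → ℝ) × ℝ) + t • ((0, 0, 1) : (ι → ℝ) × (ι → ℝ) × ℝ) := by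
        refine Prod.ext ?_ (Prod.ext ?_ ?_)
        · simp only [Prod.fst_add, Prod.fst_sum, Prod.smul_fst, smul_zero,
            Finset.sum_const_zero, add_zero]
          ext i; simp [Finset.sum_apply, Pi.single_apply]
        · simp only [Prod.fst_add, Prod.fst_sum, Prod.smul_fst, Prod.snd_add, Prod.snd_sum,
            Prod.smul_snd, smul_zero, Finset.sum_const_zero, add_zero, zero_add]
          ext i; simp [Finset.sum_apply, Pi.single_apply]
        · simp [Prod.snd_sum]
      rw [e]
      simp only [map_add, map_sum, map_smul, smul_eq_mul, φ, ψ, l]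
      simp only [mul_comm]
    have h1 : ∀ i j, φ i + ψ j + l * c i j < u := by
      intro i j
      have := hu (T (Pi.single (i, j) 1)) ⟨_, single_mem_stdSimplex ℝ (i, j), rfl⟩
      have e : T (Pi.single (i, j) 1) = (Pi.single i 1, Pi.single j 1, c i j) := by
        refine Prod.ext ?_ (Prod.ext ?_ ?_)
        · ext k
          simp only [T, LinearMap.coe_mk, AddHom.coe_mk, Pi.single_apply, Prod.mk.injEq]
          by_cases hk : k = i <;> simp [hk]
        · ext k
          simp only [T, LinearMap.coe_mk, AddHom.coe_mk, Pi.single_apply, Prod.mk.injEq]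
          by_cases hk : k = j <;> simp [hk]
        · simp only [T, LinearMap.coe_mk, AddHom.coe_mk, Pi.single_apply, Prod.mk.injEq]
          simp [ite_and]
      rw [e, hF] at this
      simpa [Pi.single_apply] using this
    have h2 : ∀ t ≤ B, v < ∑ i, φ i * a i + ∑ j, ψ j * b j + l * t := by
      intro t ht
      have := hv (a, b, t) ⟨rfl, rfl, ht⟩
      rwa [hF] at this
    set D := ∑ i, φ i * a i + ∑ j, ψ j * b j with hD
    -- `R` is unbounded towards decreasing costs, so the weight of the cost cannot be positive.
    have hl : l ≤ 0 := by
      by_contra! hl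
      have := h2 (min B ((v - D) / l)) (min_le_left _ _)
      have h3 : l * min B ((v - D) / l) ≤ v - D := by
        calc l * min B ((v - D) / l) ≤ l * ((v - D) / l) := by gcongr; exact min_le_right _ _
          _ = v - D := by field_simp
      linarith
    rcases hl.lt_or_eq with hl | hl
    -- Rescaling by `-l > 0` gives an admissible pair. The shift by `u` changes its value by exactly
    -- `u / (-l)`, since `a` has mass one, and the value exceeds `B`.
    · have := h (fun i => (φ i - u) / (-l)) (fun j => ψ j / (-l)) (by
        intro i j
        rw [← add_div, div_le_iff₀ (by linarith)]
        linarith [h1 i j])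
      have e : ∑ i, (φ i - u) / (-l) * a i + ∑ j, ψ j / (-l) * b j = (D - u) / (-l) := by
        have e1 : ∑ i, (φ i - u) / (-l) * a i = (∑ i, φ i * a i - u * ∑ i, a i) / (-l) := by
          rw [Finset.mul_sum, ← Finset.sum_sub_distrib, Finset.sum_div]
          exact Finset.sum_congr rfl fun i _ => by ring
        have e2 : ∑ j, ψ j / (-l) * b j = (∑ j, ψ j * b j) / (-l) := by
          rw [Finset.sum_div]
          exact Finset.sum_congr rfl fun i _ => by ring
        rw [e1, e2, hD, ha]
        ring
      rw [e, div_le_iff₀ (by linarith)] at this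
      have := h2 B le_rfl
      linarith
    -- Degenerate case: `φ - u` and `ψ` have negative pairwise sums but positive total value `D -
    -- u`. The multiple by `M`, shifted by `m`, is admissible with value `|B| + 1 > B`.
    · have h3 : ∀ i j, φ i + ψ j < u := fun i j => by simpa [hl] using h1 i j
      have h4 := h2 B le_rfl
      rw [hl, zero_mul, add_zero] at h4
      set m := ∑ i, ∑ j, |c i j|
      have hm : ∀ i j, -m ≤ c i j := by
        intro i j
        have k1 : |c i j| ≤ ∑ j, |c i j| :=
          Finset.single_le_sum (f := fun j => |c i j|) (fun _ _ => abs_nonneg _) (Finset.mem_univ j)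
        have k2 : ∑ j, |c i j| ≤ m :=
          Finset.single_le_sum (f := fun i => ∑ j, |c i j|)
            (fun _ _ => Finset.sum_nonneg fun _ _ => abs_nonneg _) (Finset.mem_univ i)
        linarith [neg_abs_le (c i j)]
      set M := (|B| + m + 1) / (D - u)
      have hm0 : 0 ≤ m := Finset.sum_nonneg fun _ _ => Finset.sum_nonneg fun _ _ => abs_nonneg _
      have hDu : 0 < D - u := by linarith
      have hM : 0 ≤ M := by positivity
      have := h (fun i => M * (φ i - u) - m) (fun j => M * ψ j) (by
        intro i j
        nlinarith [h3 i j, hm i j, mul_nonneg hM (sub_nonneg.2 (h3 i j).le)])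
      have e : ∑ i, (M * (φ i - u) - m) * a i + ∑ j, M * ψ j * b j = M * (D - u) - m := by
        have e1 : ∑ i, (M * (φ i - u) - m) * a i
            = M * ∑ i, φ i * a i - (M * u + m) * ∑ i, a i := by
          rw [Finset.mul_sum, Finset.mul_sum, ← Finset.sum_sub_distrib]
          exact Finset.sum_congr rfl fun i _ => by ring
        have e2 : ∑ j, M * ψ j * b j = M * ∑ j, ψ j * b j := by
          rw [Finset.mul_sum]
          exact Finset.sum_congr rfl fun i _ => by ring
        rw [e1, e2, hD, ha]
        ring
      rw [e, div_mul_cancel₀ _ hDu.ne'] at this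
      linarith [le_abs_self B]
  · rw [Set.not_disjoint_iff] at hdisj
    obtain ⟨_, ⟨g, hg, rfl⟩, h1, h2, h3⟩ := hdisj
    exact ⟨fun i j => g (i, j), fun i j => hg.1 _, fun i => congrFun h1 i, fun j => congrFun h2 j, h3⟩

/-! ### Smooth semiconcave dual potentials. -/

section SoftMin

variable {X ι : Type*} [NormedAddCommGroup X] [Fintype ι]

/-- A smooth approximation from below of `x ↦ min_i (‖x - p i‖² - φ i)`. -/
def softMin (p : ι → X) (φ : ι → ℝ) (τ : ℝ) (x : X) : ℝ :=
  -τ * Real.log (∑ i, Real.exp (-(‖x - p i‖ ^ 2 - φ i) / τ))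

variable (p : ι → X) (φ : ι → ℝ) {τ : ℝ}

theorem softMin_le (hτ : 0 < τ) (x : X) (i : ι) : softMin p φ τ x ≤ ‖x - p i‖ ^ 2 - φ i := by
  have h1 : Real.exp (-(‖x - p i‖ ^ 2 - φ i) / τ) ≤ ∑ i, Real.exp (-(‖x - p i‖ ^ 2 - φ i) / τ) :=
    Finset.single_le_sum (f := fun i => Real.exp (-(‖x - p i‖ ^ 2 - φ i) / τ))
      (fun _ _ => (Real.exp_pos _).le) (Finset.mem_univ i)
  have h2 := (Real.le_log_iff_exp_le ((Real.exp_pos _).trans_le h1)).2 h1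
  rw [div_le_iff₀ hτ] at h2
  unfold softMin
  linarith

/-- The sum is at most its number of terms times the largest one; the logarithm of that number,
times `τ`, is the error, made negligible later by the choice of `τ`. -/
theorem le_softMin [Nonempty ι] (hτ : 0 < τ) (x : X) {m : ℝ} (h : ∀ i, m ≤ ‖x - p i‖ ^ 2 - φ i) :
    m - τ * Real.log (Fintype.card ι) ≤ softMin p φ τ x := by
  have h1 : ∑ i, Real.exp (-(‖x - p i‖ ^ 2 - φ i) / τ) ≤ Fintype.card ι * Real.exp (-m / τ) := by
    rw [← nsmul_eq_mul, ← Finset.card_univ, ← Finset.sum_const]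
    gcongr with i
    exact h i
  have h0 : 0 < ∑ i, Real.exp (-(‖x - p i‖ ^ 2 - φ i) / τ) :=
    Finset.sum_pos (fun _ _ => Real.exp_pos _) Finset.univ_nonempty
  have h2 := Real.log_le_log h0 h1
  rw [Real.log_mul (by positivity) (Real.exp_ne_zero _), Real.log_exp] at h2
  have h3 := mul_le_mul_of_nonneg_left h2 hτ.le
  have h4 : τ * (-m / τ) = -m := by field_simp
  unfold softMin
  linarith

theorem exists_abs_softMin_le [Nonempty ι] (hτ : 0 < τ) :
    ∃ A, ∀ x, |softMin p φ τ x| ≤ A * (1 + ‖x‖) ^ 2 := by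
  obtain ⟨i₀⟩ := ‹Nonempty ι›
  have : Nonempty ι := ⟨i₀⟩
  set P := ∑ i, |φ i|
  have hP : ∀ i, |φ i| ≤ P := fun i =>
    Finset.single_le_sum (f := fun i => |φ i|) (fun _ _ => abs_nonneg _) (Finset.mem_univ i)
  set L := τ * Real.log (Fintype.card ι)
  have hL : 0 ≤ L := mul_nonneg hτ.le (Real.log_natCast_nonneg _)
  have hP0 : 0 ≤ P := (abs_nonneg _).trans (hP i₀)
  refine ⟨(1 + ‖p i₀‖) ^ 2 + P + L, fun x => ?_⟩
  have h1 := softMin_le p φ hτ x i₀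
  have h2 := le_softMin p φ hτ x (m := -P) fun i => by
    nlinarith [le_abs_self (φ i), hP i, sq_nonneg ‖x - p i‖]
  have h3 : ‖x - p i₀‖ ≤ (1 + ‖p i₀‖) * (1 + ‖x‖) := by
    nlinarith [norm_sub_le x (p i₀), norm_nonneg x, norm_nonneg (p i₀)]
  have h4 : ‖x - p i₀‖ ^ 2 ≤ ((1 + ‖p i₀‖) * (1 + ‖x‖)) ^ 2 := by gcongr
  have h5 : 1 ≤ (1 + ‖x‖) ^ 2 := by nlinarith [norm_nonneg x]
  have h6 := neg_abs_le (φ i₀)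
  have h7 := hP i₀
  have h8 : P + L ≤ (P + L) * (1 + ‖x‖) ^ 2 := by nlinarith
  rw [abs_le]
  constructor
  · nlinarith [sq_nonneg ((1 + ‖p i₀‖) * (1 + ‖x‖))]
  · nlinarith

/-- The Gibbs weights of `softMin`. -/
def softWeight (p : ι → X) (φ : ι → ℝ) (τ : ℝ) (x : X) (i : ι) : ℝ :=
  Real.exp (-(‖x - p i‖ ^ 2 - φ i) / τ) / ∑ i, Real.exp (-(‖x - p i‖ ^ 2 - φ i) / τ)

theorem softWeight_nonneg (x : X) (i : ι) : 0 ≤ softWeight p φ τ x i := by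
  unfold softWeight; positivity

theorem sum_softWeight [Nonempty ι] (x : X) : ∑ i, softWeight p φ τ x i = 1 := by
  unfold softWeight
  rw [← Finset.sum_div, div_self]
  exact (Finset.sum_pos (fun _ _ => Real.exp_pos _) Finset.univ_nonempty).ne'

variable [InnerProductSpace ℝ X]

theorem contDiff_softMin [Nonempty ι] {n : WithTop ℕ∞} : ContDiff ℝ n (softMin p φ τ) := by
  unfold softMin
  refine contDiff_const.mul (ContDiff.log ?_ fun x =>
    (Finset.sum_pos (fun _ _ => Real.exp_pos _) Finset.univ_nonempty).ne')
  refine ContDiff.sum fun i _ => Real.contDiff_exp.comp ?_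
  refine (ContDiff.neg (ContDiff.sub ?_ contDiff_const)).div_const _
  exact (contDiff_id.sub contDiff_const).norm_sq ℝ

theorem fderiv_softMin [Nonempty ι] (hτ : 0 < τ) (x v : X) :
    fderiv ℝ (softMin p φ τ) x v = ∑ i, softWeight p φ τ x i * (2 * inner ℝ (x - p i) v) := by
  have h0 : ∑ i, Real.exp (-(‖x - p i‖ ^ 2 - φ i) / τ) ≠ 0 :=
    (Finset.sum_pos (fun _ _ => Real.exp_pos _) Finset.univ_nonempty).ne'
  have h1 : ∀ i, HasFDerivAt (fun x : X => Real.exp (-(‖x - p i‖ ^ 2 - φ i) / τ))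
      (Real.exp (-(‖x - p i‖ ^ 2 - φ i) / τ) • ((-2 / τ) • (innerSL ℝ (x - p i) : X →L[ℝ] ℝ))) x := by
    intro i
    have h2 : HasFDerivAt (fun x : X => ‖x - p i‖ ^ 2)
        (2 • (innerSL ℝ (x - p i) : X →L[ℝ] ℝ)) x := by
      have := ((hasFDerivAt_id x).sub_const (p i)).norm_sq
      simpa using this
    have h3 := ((h2.sub_const (φ i)).neg.mul_const τ⁻¹).exp
    simp only [← div_eq_mul_inv] at h3
    refine h3.congr_fderiv ?_
    ext w
    simp
    ring
  have h4 := ((HasFDerivAt.fun_sum fun i (_ : i ∈ Finset.univ) => h1 i).log h0).const_mul (-τ)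
  have h5 : HasFDerivAt (softMin p φ τ) _ x := h4
  rw [h5.fderiv]
  simp only [smul_apply, sum_apply, innerSL_apply_apply, smul_eq_mul, softWeight, Finset.mul_sum]
  refine Finset.sum_congr rfl fun i _ => ?_
  field_simp

/-- Semiconcavity, inherited from the quadratics under the minimum. The partition functions at `x +
v` and `x` have as ratio a mean of exponentials under the weights at `x`, and Jensen's inequality
bounds it below. -/
theorem softMin_add_le [Nonempty ι] (hτ : 0 < τ) (x v : X) :
    softMin p φ τ (x + v) ≤ softMin p φ τ x + fderiv ℝ (softMin p φ τ) x v + ‖v‖ ^ 2 := by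
  rw [fderiv_softMin p φ hτ]
  set S := ∑ i, Real.exp (-(‖x - p i‖ ^ 2 - φ i) / τ) with hS
  have h0 : 0 < S := Finset.sum_pos (fun _ _ => Real.exp_pos _) Finset.univ_nonempty
  set t : ι → ℝ := fun i => -(2 * inner ℝ (x - p i) v + ‖v‖ ^ 2) / τ with ht
  have h1 : ∑ i, Real.exp (-(‖x + v - p i‖ ^ 2 - φ i) / τ)
      = S * ∑ i, softWeight p φ τ x i * Real.exp (t i) := by
    rw [Finset.mul_sum]
    refine Finset.sum_congr rfl fun i _ => ?_
    have : x + v - p i = (x - p i) + v := by abel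
    rw [this, norm_add_sq_real, softWeight, ← hS]
    have e : -(‖x - p i‖ ^ 2 + 2 * inner ℝ (x - p i) v + ‖v‖ ^ 2 - φ i) / τ
        = -(‖x - p i‖ ^ 2 - φ i) / τ + t i := by
      rw [ht]; ring
    rw [e, Real.exp_add]
    field_simp
  have h2 : Real.exp (∑ i, softWeight p φ τ x i * t i)
      ≤ ∑ i, softWeight p φ τ x i * Real.exp (t i) := by
    have := convexOn_exp.map_sum_le (t := Finset.univ) (w := softWeight p φ τ x) (p := t)
      (fun i _ => softWeight_nonneg p φ x i) (sum_softWeight p φ x) (fun _ _ => Set.mem_univ _)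
    simpa using this
  have h3 := (Real.le_log_iff_exp_le ((Real.exp_pos _).trans_le h2)).2 h2
  have h4 : ∑ i, softWeight p φ τ x i * t i
      = -(∑ i, softWeight p φ τ x i * (2 * inner ℝ (x - p i) v) + ‖v‖ ^ 2) / τ := by
    have : ‖v‖ ^ 2 = ∑ i, softWeight p φ τ x i * ‖v‖ ^ 2 := by
      rw [← Finset.sum_mul, sum_softWeight, one_mul]
    rw [this, ← Finset.sum_add_distrib, ← Finset.sum_neg_distrib, Finset.sum_div]
    refine Finset.sum_congr rfl fun i _ => ?_
    rw [ht]; ring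
  rw [h4, div_le_iff₀ hτ] at h3
  unfold softMin
  rw [h1, Real.log_mul h0.ne' ((Real.exp_pos _).trans_le h2).ne', ← hS]
  linarith

theorem norm_fderiv_softMin_le [Nonempty ι] (hτ : 0 < τ) (x : X) :
    ‖fderiv ℝ (softMin p φ τ) x‖ ≤ (2 * (1 + ∑ i, ‖p i‖)) * (1 + ‖x‖) := by
  refine ContinuousLinearMap.opNorm_le_bound _ (by positivity) fun v => ?_
  rw [fderiv_softMin p φ hτ]
  have h1 : ∀ i, ‖softWeight p φ τ x i * (2 * inner ℝ (x - p i) v)‖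
      ≤ softWeight p φ τ x i * ((2 * (1 + ∑ i, ‖p i‖)) * (1 + ‖x‖) * ‖v‖) := by
    intro i
    rw [norm_mul, Real.norm_of_nonneg (softWeight_nonneg p φ x i), norm_mul]
    refine mul_le_mul_of_nonneg_left ?_ (softWeight_nonneg p φ x i)
    have h2 : ‖p i‖ ≤ ∑ i, ‖p i‖ :=
      Finset.single_le_sum (f := fun i => ‖p i‖) (fun _ _ => norm_nonneg _) (Finset.mem_univ i)
    have h3 : ‖x - p i‖ ≤ (1 + ∑ i, ‖p i‖) * (1 + ‖x‖) := by
      nlinarith [norm_sub_le x (p i), norm_nonneg x, norm_nonneg (p i)]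
    calc ‖(2 : ℝ)‖ * ‖inner ℝ (x - p i) v‖ ≤ 2 * (‖x - p i‖ * ‖v‖) := by
          rw [Real.norm_of_nonneg (by norm_num : (0 : ℝ) ≤ 2)]
          gcongr; exact norm_inner_le_norm _ _
      _ ≤ 2 * (((1 + ∑ i, ‖p i‖) * (1 + ‖x‖)) * ‖v‖) := by gcongr
      _ = _ := by ring
  refine (norm_sum_le _ _).trans ((Finset.sum_le_sum fun i _ => h1 i).trans ?_)
  rw [← Finset.sum_mul, sum_softWeight, one_mul]

/-- An infinitesimal gain for the infimal convolution of `softMin` with `‖·‖²`. -/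
theorem exists_softMin_gain [CompleteSpace X] [Nonempty ι] (hτ : 0 < τ) (y : X) :
    ∃ x, ‖x - y‖ ^ 2 + softMin p φ τ x
      ≤ softMin p φ τ y - ‖fderiv ℝ (softMin p φ τ) y‖ ^ 2 / 8 := by
  set g := (InnerProductSpace.toDual ℝ X).symm (fderiv ℝ (softMin p φ τ) y) with hg
  have hn : ‖g‖ = ‖fderiv ℝ (softMin p φ τ) y‖ := by rw [hg, LinearIsometryEquiv.norm_map]
  have hf : fderiv ℝ (softMin p φ τ) y g = ‖g‖ ^ 2 := by
    rw [← real_inner_self_eq_norm_sq, hg, InnerProductSpace.toDual_symm_apply]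
  -- `v = -g/4` minimizes `2‖v‖² + ⟪g, v⟫`, the excess given by semiconcavity; the minimum is
  -- `-‖g‖²/8`.
  refine ⟨y + (-(1 / 4 : ℝ)) • g, ?_⟩
  have h1 := softMin_add_le p φ hτ y ((-(1 / 4 : ℝ)) • g)
  rw [map_smul, hf, norm_smul] at h1
  rw [add_sub_cancel_left, norm_smul, ← hn]
  norm_num at h1 ⊢
  nlinarith

/-- The dual potentials of a discrete transport problem are dominated by `softMin`. -/
theorem dual_le_softMin [CompleteSpace X] [Nonempty ι] (hτ : 0 < τ) (ψ : ι → ℝ)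
    (h : ∀ i j, φ i + ψ j ≤ 1 / 4 * ‖p i - p j‖ ^ 2) (y : X) (j : ι) :
    ψ j ≤ softMin p φ τ y - ‖fderiv ℝ (softMin p φ τ) y‖ ^ 2 / 8 + ‖y - p j‖ ^ 2
      + τ * Real.log (Fintype.card ι) := by
  obtain ⟨x, hx⟩ := exists_softMin_gain p φ hτ y
  have h1 := le_softMin p φ hτ x (m := ψ j - ‖y - p j‖ ^ 2 - ‖x - y‖ ^ 2) fun i => by
    have e1 : ‖p i - p j‖ ≤ ‖x - p i‖ + ‖x - y‖ + ‖y - p j‖ := by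
      have : p i - p j = -(x - p i) + (x - y) + (y - p j) := by abel
      rw [this]
      refine (norm_add_le _ _).trans ?_
      gcongr
      refine (norm_add_le _ _).trans ?_
      rw [norm_neg]
    have e2 : ‖p i - p j‖ ^ 2 ≤ (‖x - p i‖ + ‖x - y‖ + ‖y - p j‖) ^ 2 := by gcongr
    -- The square of a sum of three lengths is at most three times the sum of squares, and the
    -- factor `1/4` in the cost pays for it.
    nlinarith [h i j, sq_nonneg (‖x - p i‖ - ‖x - y‖), sq_nonneg (‖x - p i‖ - ‖y - p j‖),
      sq_nonneg (‖x - y‖ - ‖y - p j‖)]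
  linarith

end SoftMin

theorem integrable_norm_sq_of_eLpNorm_le {X : Type*} [NormedAddCommGroup X]
    [MeasurableSpace X] {μ : Measure X} {g : X → X} (hg : AEStronglyMeasurable g μ)
    {ε : ℝ} (hε : 0 ≤ ε) (h : eLpNorm g 2 μ ≤ ENNReal.ofReal ε) :
    Integrable (fun x => ‖g x‖ ^ 2) μ ∧ ∫ x, ‖g x‖ ^ 2 ∂μ ≤ ε ^ 2 := by
  have hm : MemLp g 2 μ := ⟨hg, h.trans_lt ENNReal.ofReal_lt_top⟩
  refine ⟨hm.integrable_norm_pow (by norm_num), ?_⟩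
  rw [hm.eLpNorm_eq_integral_rpow_norm (by norm_num) (by norm_num)] at h
  have h0 : 0 ≤ ∫ x, ‖g x‖ ^ 2 ∂μ := integral_nonneg fun x => sq_nonneg _
  have h1 := (ENNReal.ofReal_le_ofReal_iff hε).1 h
  simp only [ENNReal.toReal_ofNat, Real.rpow_ofNat] at h1
  rw [← one_div, ← Real.sqrt_eq_rpow] at h1
  exact (Real.sqrt_le_left hε).1 h1

/-! ### Reduction to finitely supported measures. -/

section Discretization

variable {X ι : Type*} [NormedAddCommGroup X] [MeasurableSpace X] [BorelSpace X]

theorem integrable_of_abs_le_quadratic {μ : Measure X} [IsFiniteMeasure μ] (hμ : MemLp id 2 μ)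
    {f : X → ℝ} (hf : Continuous f) {A : ℝ} (hA : ∀ x, |f x| ≤ A * (1 + ‖x‖) ^ 2) :
    Integrable f μ := by
  have h1 : Integrable (fun x : X => ‖x‖ ^ 2) μ := hμ.integrable_norm_pow (by norm_num)
  have hA0 : 0 ≤ A := by simpa using (abs_nonneg _).trans (hA 0)
  refine (((integrable_const (1 : ℝ)).add h1).const_mul (A * 2)).mono'
    hf.aestronglyMeasurable (Filter.Eventually.of_forall fun x => (hA x).trans ?_)
  have : (1 + ‖x‖) ^ 2 ≤ 2 * (1 + ‖x‖ ^ 2) := by nlinarith [sq_nonneg (1 - ‖x‖)]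
  calc A * (1 + ‖x‖) ^ 2 ≤ A * (2 * (1 + ‖x‖ ^ 2)) := by gcongr
    _ = _ := by simp [mul_assoc]

variable [SecondCountableTopology X] [Fintype ι] [MeasurableSpace ι] [MeasurableSingletonClass ι]

/-- Both pushforwards live on finitely many atoms, so finite duality supplies the plan. The `4`
undoes the `1/4` in the dual cost, which gives `dual_le_softMin` its room. -/
theorem W2_map_le (μ ν : Measure X) [IsProbabilityMeasure μ] [IsProbabilityMeasure ν]
    {T : X → ι} (hT : Measurable T) (p : ι → X) (B : ℝ)
    (h : ∀ φ ψ : ι → ℝ, (∀ i j, φ i + ψ j ≤ 1 / 4 * ‖p i - p j‖ ^ 2) →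
      ∫ x, φ (T x) ∂μ + ∫ y, ψ (T y) ∂ν ≤ B) :
    W2 (μ.map (p ∘ T)) (ν.map (p ∘ T)) ≤ ENNReal.ofReal (4 * B) ^ (1 / 2 : ℝ) := by
  classical
  have hp : Measurable p := measurable_of_finite p
  have hμT : IsProbabilityMeasure (μ.map T) := Measure.isProbabilityMeasure_map hT.aemeasurable
  have hνT : IsProbabilityMeasure (ν.map T) := Measure.isProbabilityMeasure_map hT.aemeasurable
  have hint : ∀ (μ : Measure X) [IsProbabilityMeasure μ] (φ : ι → ℝ),
      ∫ x, φ (T x) ∂μ = ∑ i, φ i * (μ.map T).real {i} := by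
    intro μ _ φ
    have : IsProbabilityMeasure (μ.map T) := Measure.isProbabilityMeasure_map hT.aemeasurable
    rw [← integral_map hT.aemeasurable (f := φ) (measurable_of_finite φ).aestronglyMeasurable,
      integral_fintype .of_finite]
    simp [mul_comm]
  obtain ⟨g, hg0, hga, hgb, hgc⟩ := exists_discrete_coupling
    (fun i j => 1 / 4 * ‖p i - p j‖ ^ 2) (fun i => (μ.map T).real {i})
    (fun i => (ν.map T).real {i}) (by simp) B (fun φ ψ hφψ => by
      rw [← hint, ← hint]; exact h φ ψ hφψ)
  set Γ : Measure (ι × ι) := ∑ q : ι × ι, ENNReal.ofReal (g q.1 q.2) • Measure.dirac q with hΓ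
  have hΓ1 : Γ.map Prod.fst = μ.map T := by
    refine Measure.ext_of_singleton fun a => ?_
    rw [Measure.map_apply measurable_fst (MeasurableSet.singleton a), hΓ, Measure.finsetSum_apply,
      Fintype.sum_prod_type]
    simp only [Measure.smul_apply, Measure.dirac_apply, smul_eq_mul, Set.indicator_apply,
      Set.mem_preimage, Set.mem_singleton_iff, Pi.one_apply, mul_ite, mul_one, mul_zero]
    rw [Finset.sum_eq_single a (by intro b _ hb; simp [hb]) (by simp)]
    simp only [if_true]
    rw [← ENNReal.ofReal_sum_of_nonneg (fun j _ => hg0 a j), hga, ofReal_measureReal]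
  have hΓ2 : Γ.map Prod.snd = ν.map T := by
    refine Measure.ext_of_singleton fun a => ?_
    rw [Measure.map_apply measurable_snd (MeasurableSet.singleton a), hΓ, Measure.finsetSum_apply,
      Fintype.sum_prod_type_right]
    simp only [Measure.smul_apply, Measure.dirac_apply, smul_eq_mul, Set.indicator_apply,
      Set.mem_preimage, Set.mem_singleton_iff, Pi.one_apply, mul_ite, mul_one, mul_zero]
    rw [Finset.sum_eq_single a (by intro b _ hb; simp [hb]) (by simp)]
    simp only [if_true]
    rw [← ENNReal.ofReal_sum_of_nonneg (fun j _ => hg0 j a), hgb, ofReal_measureReal]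
  refine (W2_le_of_coupling (Γ.map (Prod.map p p)) ?_ ?_).trans ?_
  · rw [Measure.map_map measurable_fst (by fun_prop), ← Measure.map_map hp hT, ← hΓ1,
      Measure.map_map hp measurable_fst]
    rfl
  · rw [Measure.map_map measurable_snd (by fun_prop), ← Measure.map_map hp hT, ← hΓ2,
      Measure.map_map hp measurable_snd]
    rfl
  · refine ENNReal.rpow_le_rpow ?_ (by norm_num)
    rw [lintegral_map (by fun_prop) (by fun_prop), hΓ, lintegral_finsetSum_measure]
    have e : ∀ q : ι × ι, ∫⁻ a, edist (Prod.map p p a).1 (Prod.map p p a).2 ^ (2 : ℝ)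
        ∂(ENNReal.ofReal (g q.1 q.2) • Measure.dirac q)
        = ENNReal.ofReal (g q.1 q.2 * ‖p q.1 - p q.2‖ ^ 2) := by
      intro q
      rw [lintegral_smul_measure, lintegral_dirac, ENNReal.ofReal_mul (hg0 _ _), smul_eq_mul,
        Prod.map_fst, Prod.map_snd, edist_eq_enorm_sub, ENNReal.ofReal_pow (norm_nonneg _),
        ofReal_norm, ENNReal.rpow_ofNat]
    simp only [e]
    rw [← ENNReal.ofReal_sum_of_nonneg fun q _ => mul_nonneg (hg0 _ _) (sq_nonneg _),
      Fintype.sum_prod_type]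
    refine ENNReal.ofReal_le_ofReal ?_
    have : ∑ i, ∑ j, g i j * ‖p i - p j‖ ^ 2
        = 4 * ∑ i, ∑ j, g i j * (1 / 4 * ‖p i - p j‖ ^ 2) := by
      simp only [Finset.mul_sum]
      refine Finset.sum_congr rfl fun i _ => Finset.sum_congr rfl fun j _ => by ring
    rw [this]
    linarith

theorem W2_map_le_eLpNorm (μ : Measure X) {S : X → X} (hS : Measurable S) :
    W2 μ (μ.map S) ≤ eLpNorm (S - id) 2 μ := by
  refine (W2_le_of_coupling (μ.map (fun x => (x, S x))) ?_ ?_).trans ?_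
  · rw [Measure.map_map measurable_fst (by fun_prop)]
    exact Measure.map_id
  · rw [Measure.map_map measurable_snd (by fun_prop)]
    rfl
  · rw [lintegral_map (by fun_prop) (by fun_prop),
      eLpNorm_eq_lintegral_rpow_enorm_toReal (by norm_num) (by norm_num)]
    simp [edist_eq_enorm_sub, enorm_sub_rev]

theorem exists_simpleFunc_approx (μ ν : Measure X) (hμ : MemLp id 2 μ) (hν : MemLp id 2 ν) {ε : ℝ}
    (hε : 0 < ε) : ∃ S : SimpleFunc X X,
      eLpNorm (⇑S - id) 2 μ ≤ ENNReal.ofReal ε ∧ eLpNorm (⇑S - id) 2 ν ≤ ENNReal.ofReal ε := by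
  have key : ∀ μ : Measure X, MemLp id 2 μ → ∀ᶠ n in Filter.atTop,
      eLpNorm (⇑(SimpleFunc.approxOn (id : X → X) measurable_id Set.univ 0 trivial n) - id) 2 μ
        ≤ ENNReal.ofReal ε := by
    intro μ hμ
    have := SimpleFunc.tendsto_approxOn_Lp_eLpNorm (p := 2) (measurable_id (α := X))
      (s := Set.univ) (y₀ := 0) trivial (by norm_num) (μ := μ) (by simp)
      (by simpa [Function.id_def] using hμ.2)
    exact this.eventually (Iic_mem_nhds (by simpa using hε))
  obtain ⟨n, h1, h2⟩ := ((key μ hμ).and (key ν hν)).exists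
  exact ⟨_, h1, h2⟩


end Discretization

/-! ### From a dual Sobolev bound to a Wasserstein bound. -/

section WeakBound

variable {X : Type*} [NormedAddCommGroup X] [InnerProductSpace ℝ X] [CompleteSpace X]
  [MeasurableSpace X] [BorelSpace X] [SecondCountableTopology X] [StandardBorelSpace X]

/-- A bound on the `H⁻¹`-norm of `ν - μ` relative to `ν` bounds `W₂(μ, ν)`. -/
theorem W2_le_of_weak_bound (μ ν : Measure X) [IsProbabilityMeasure μ] [IsProbabilityMeasure ν]
    (hμ : MemLp id 2 μ) (hν : MemLp id 2 ν) {D : ℝ} (hD : 0 ≤ D)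
    (h : ∀ f : X → ℝ, ContDiff ℝ 1 f → (∃ A, ∀ x, |f x| ≤ A * (1 + ‖x‖) ^ 2) →
      (∃ A, ∀ x, ‖fderiv ℝ f x‖ ≤ A * (1 + ‖x‖)) →
      ∫ x, f x ∂ν - ∫ x, f x ∂μ ≤ D * √(∫ x, ‖fderiv ℝ f x‖ ^ 2 ∂ν)) :
    W2 μ ν ≤ ENNReal.ofReal (3 * D) := by
  refine ENNReal.le_of_forall_pos_le_add fun η hη _ => ?_
  set ε : ℝ := η / 6 with hε_def
  have hε : 0 < ε := by positivity
  obtain ⟨S, hS1, hS2⟩ := exists_simpleFunc_approx μ ν hμ hν hε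
  have hSm := S.measurable
  obtain ⟨hI1, hI1'⟩ : Integrable (fun x => ‖S x - x‖ ^ 2) μ ∧
      ∫ x, ‖S x - x‖ ^ 2 ∂μ ≤ ε ^ 2 := integrable_norm_sq_of_eLpNorm_le
    (hSm.sub measurable_id).aestronglyMeasurable hε.le hS1
  obtain ⟨hI2, hI2'⟩ : Integrable (fun x => ‖S x - x‖ ^ 2) ν ∧
      ∫ x, ‖S x - x‖ ^ 2 ∂ν ≤ ε ^ 2 := integrable_norm_sq_of_eLpNorm_le
    (hSm.sub measurable_id).aestronglyMeasurable hε.le hS2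
  let T : X → S.range := fun x => ⟨S x, SimpleFunc.mem_range_self S x⟩
  have hT : Measurable T := hSm.subtype_mk
  let p : S.range → X := Subtype.val
  have : Nonempty S.range := ⟨T 0⟩
  set L := Real.log (Fintype.card S.range) with hL_def
  have hL : 0 ≤ L := Real.log_natCast_nonneg _
  have hmid : W2 (μ.map (p ∘ T)) (ν.map (p ∘ T)) ≤ ENNReal.ofReal (3 * D + 4 * ε) := by
    -- `2D²` is the maximum of `D√A - A/8` with `A = E‖∇f‖²`; the three `ε²` are the two
    -- discretization errors and the `softMin` error `τ L`.
    refine (W2_map_le μ ν hT p (2 * D ^ 2 + 3 * ε ^ 2) fun φ ψ hφψ => ?_).trans ?_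
    · set τ := ε ^ 2 / (1 + L) with hτ_def
      have hτ : 0 < τ := by positivity
      have hτL : τ * L ≤ ε ^ 2 := by
        rw [hτ_def, div_mul_eq_mul_div, div_le_iff₀ (by positivity)]
        nlinarith [sq_nonneg ε]
      set f := softMin p φ τ with hf_def
      have hfc : ContDiff ℝ 1 f := contDiff_softMin p φ
      obtain ⟨A, hA⟩ := exists_abs_softMin_le p φ hτ
      have hA' := norm_fderiv_softMin_le p φ hτ
      have hfμ : Integrable f μ := integrable_of_abs_le_quadratic hμ hfc.continuous hA
      have hfν : Integrable f ν := integrable_of_abs_le_quadratic hν hfc.continuous hA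
      have hf'ν : Integrable (fun y => ‖fderiv ℝ f y‖ ^ 2) ν := by
        refine integrable_of_abs_le_quadratic hν
          ((hfc.continuous_fderiv one_ne_zero).norm.pow 2)
          (A := (2 * (1 + ∑ i, ‖p i‖)) ^ 2) fun x => ?_
        rw [abs_of_nonneg (sq_nonneg _), ← mul_pow]
        have := hA' x
        gcongr
      have h1 : ∫ x, φ (T x) ∂μ ≤ ∫ x, (‖S x - x‖ ^ 2 - f x) ∂μ := by
        refine integral_mono (Integrable.of_finite.comp_measurable hT) (hI1.sub hfμ) fun x => ?_
        have := softMin_le p φ hτ x (T x)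
        rw [norm_sub_rev] at this
        change f x ≤ ‖S x - x‖ ^ 2 - φ (T x) at this
        linarith
      have hJ1 : Integrable (fun y => f y - ‖fderiv ℝ f y‖ ^ 2 / 8) ν := hfν.sub (hf'ν.div_const 8)
      have hJ2 : Integrable (fun y => f y - ‖fderiv ℝ f y‖ ^ 2 / 8 + ‖S y - y‖ ^ 2) ν :=
        hJ1.add hI2
      have h2 : ∫ y, ψ (T y) ∂ν ≤ ∫ y, (f y - ‖fderiv ℝ f y‖ ^ 2 / 8 + ‖S y - y‖ ^ 2
          + τ * L) ∂ν := by
        refine integral_mono (Integrable.of_finite.comp_measurable hT)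
          (hJ2.add (integrable_const _)) fun y => ?_
        have := dual_le_softMin p φ hτ ψ hφψ y (T y)
        rw [norm_sub_rev y] at this
        exact this
      rw [integral_sub hI1 hfμ] at h1
      rw [integral_add hJ2 (integrable_const _), integral_add hJ1 hI2,
        integral_sub hfν (hf'ν.div_const 8), integral_div] at h2
      have h3 := h f hfc ⟨A, hA⟩ ⟨_, hA'⟩
      have h4 : 0 ≤ ∫ y, ‖fderiv ℝ f y‖ ^ 2 ∂ν := integral_nonneg fun _ => sq_nonneg _
      have h5 := Real.sq_sqrt h4
      simp only [integral_const, probReal_univ, one_smul] at h2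
      nlinarith [sq_nonneg (√(∫ y, ‖fderiv ℝ f y‖ ^ 2 ∂ν) - 4 * D)]
    -- `4(2D² + 3ε²) ≤ (3D + 4ε)²`; here `√8` is rounded up to `3`.
    · rw [ENNReal.ofReal_rpow_of_nonneg (by positivity) (by norm_num), ← Real.sqrt_eq_rpow]
      refine ENNReal.ofReal_le_ofReal (Real.sqrt_le_iff.2 ⟨by positivity, ?_⟩)
      nlinarith [mul_nonneg hD hε.le, sq_nonneg D, sq_nonneg ε]
  have hpT : p ∘ T = S := rfl
  rw [hpT] at hmid
  have : IsProbabilityMeasure (μ.map S) := Measure.isProbabilityMeasure_map hSm.aemeasurable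
  have : IsProbabilityMeasure (ν.map S) := Measure.isProbabilityMeasure_map hSm.aemeasurable
  calc W2 μ ν ≤ W2 μ (μ.map S) + W2 (μ.map S) ν := W2_triangle _ _ _
    _ ≤ W2 μ (μ.map S) + (W2 (μ.map S) (ν.map S) + W2 (ν.map S) ν) := by
      gcongr; exact W2_triangle _ _ _
    _ ≤ ENNReal.ofReal ε + (ENNReal.ofReal (3 * D + 4 * ε) + ENNReal.ofReal ε) := by
      gcongr
      · exact (W2_map_le_eLpNorm μ hSm).trans hS1
      · rw [W2_comm]
        exact (W2_map_le_eLpNorm ν hSm).trans hS2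
    _ = ENNReal.ofReal (3 * D) + η := by
      rw [← ENNReal.ofReal_add (by positivity) hε.le, ← ENNReal.ofReal_add hε.le (by positivity),
        ← ENNReal.ofReal_coe_nnreal (p := η), ← ENNReal.ofReal_add (by positivity) η.coe_nonneg]
      congr 1
      rw [hε_def]; ring

end WeakBound

/-! ### The Poincaré inequality for nonnegative, then bounded functions. -/

section Poincare

variable {X : Type*} [MeasurableSpace X]

/-- Dominated convergence in the three integrals. This carries the inequality through successive
enlargements of the class of test functions. -/
theorem var_le_of_tendsto {μ : Measure X} [IsProbabilityMeasure μ] {F G : ℕ → X → ℝ}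
    {f g b c : X → ℝ} (hF : ∀ n, AEStronglyMeasurable (F n) μ)
    (hG : ∀ n, AEStronglyMeasurable (G n) μ) (hb : MemLp b 2 μ) (hc : MemLp c 2 μ)
    (hFb : ∀ n x, |F n x| ≤ b x) (hGc : ∀ n x, |G n x| ≤ c x)
    (hFf : ∀ x, Filter.Tendsto (fun n => F n x) Filter.atTop (nhds (f x)))
    (hGg : ∀ x, Filter.Tendsto (fun n => G n x) Filter.atTop (nhds (g x))) {K : ℝ}
    (h : ∀ n, ∫ x, F n x ^ 2 ∂μ - (∫ x, F n x ∂μ) ^ 2 ≤ K * ∫ x, G n x ^ 2 ∂μ) :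
    ∫ x, f x ^ 2 ∂μ - (∫ x, f x ∂μ) ^ 2 ≤ K * ∫ x, g x ^ 2 ∂μ := by
  have sq_bound : ∀ {a b : ℝ}, |a| ≤ b → ‖a ^ 2‖ ≤ b ^ 2 := fun {a b} hab => by
    rw [Real.norm_of_nonneg (sq_nonneg _), ← sq_abs]
    gcongr
  have h1 := tendsto_integral_of_dominated_convergence (μ := μ) (F := fun n x => F n x ^ 2)
    (fun x => b x ^ 2) (fun n => (hF n).pow 2) hb.integrable_sq
    (fun n => .of_forall fun x => sq_bound (hFb n x)) (.of_forall fun x => (hFf x).pow 2)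
  have h2 := tendsto_integral_of_dominated_convergence (μ := μ) (F := F)
    b hF (hb.integrable (by norm_num))
    (fun n => .of_forall fun x => hFb n x) (.of_forall fun x => (hFf x))
  have h3 := tendsto_integral_of_dominated_convergence (μ := μ) (F := fun n x => G n x ^ 2)
    (fun x => c x ^ 2) (fun n => (hG n).pow 2) hc.integrable_sq
    (fun n => .of_forall fun x => sq_bound (hGc n x)) (.of_forall fun x => (hGg x).pow 2)
  exact le_of_tendsto_of_tendsto' (h1.sub (h2.pow 2)) (h3.const_mul K) h

variable [NormedAddCommGroup X] [InnerProductSpace ℝ X] [FiniteDimensional ℝ X] [BorelSpace X]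

/-- With `m = √(E F²)`, the bound `log t ≥ 1 - 1/t` at `t = F/m` gives entropy at least `2m² - 2m E
F`, which exceeds the variance by `(m - E F)²`. No linearization around constants is needed; the
price is the Poincaré constant `2C`. -/
theorem sub_sq_le_ent {μ : Measure X} [IsProbabilityMeasure μ] {F : X → ℝ} (hF : Continuous F)
    (hFc : HasCompactSupport F) (hF0 : ∀ x, 0 ≤ F x) (hpos : 0 < ∫ x, F x ^ 2 ∂μ) :
    ∫ x, F x ^ 2 ∂μ - (∫ x, F x ∂μ) ^ 2 ≤ ent μ (fun x => F x ^ 2) := by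
  set s := ∫ x, F x ^ 2 ∂μ
  set m := √s with hm_def
  have hm : 0 < m := Real.sqrt_pos.2 hpos
  have hms : m ^ 2 = s := Real.sq_sqrt hpos.le
  have hI1 : Integrable F μ := hF.integrable_of_hasCompactSupport hFc
  have hFc2 : HasCompactSupport (fun x => F x ^ 2) :=
    hFc.comp_left (g := fun t : ℝ => t ^ 2) (by simp)
  have hI2 : Integrable (fun x => F x ^ 2) μ := (hF.pow 2).integrable_of_hasCompactSupport hFc2
  have hc : Continuous (fun x => F x ^ 2 * Real.log (F x ^ 2 / s)) := by
    have : Continuous (fun x => F x ^ 2 * Real.log (F x ^ 2) - F x ^ 2 * Real.log s) :=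
      (Real.continuous_mul_log.comp (hF.pow 2)).sub ((hF.pow 2).mul continuous_const)
    refine this.congr fun x => ?_
    rcases eq_or_ne (F x) 0 with h0 | h0
    · simp [h0]
    · rw [Real.log_div (by positivity) hpos.ne']; ring
  have hI3 : Integrable (fun x => F x ^ 2 * Real.log (F x ^ 2 / s)) μ :=
    hc.integrable_of_hasCompactSupport hFc2.mul_right
  have h1 : ∫ x, (2 * F x ^ 2 - 2 * m * F x) ∂μ ≤ ent μ (fun x => F x ^ 2) := by
    refine integral_mono ((hI2.const_mul 2).sub (hI1.const_mul (2 * m))) hI3 fun x => ?_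
    change 2 * F x ^ 2 - 2 * m * F x ≤ F x ^ 2 * Real.log (F x ^ 2 / s)
    rcases (hF0 x).eq_or_lt with h0 | h0
    · simp [← h0]
    · have h2 := Real.one_sub_inv_le_log_of_pos (div_pos h0 hm)
      rw [← hms, ← div_pow, Real.log_pow]
      have h3 : F x ^ 2 * (2 * (1 - (F x / m)⁻¹)) = 2 * F x ^ 2 - 2 * m * F x := by
        field_simp
      rw [← h3]
      push_cast
      gcongr
  rw [integral_sub (hI2.const_mul 2) (hI1.const_mul (2 * m)), integral_const_mul,
    integral_const_mul] at h1
  nlinarith [sq_nonneg (m - ∫ x, F x ∂μ)]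

omit [MeasurableSpace X] [BorelSpace X] in
theorem norm_gradient_eq (f : X → ℝ) (x : X) : ‖gradient f x‖ = ‖fderiv ℝ f x‖ := by
  rw [gradient, LinearIsometryEquiv.norm_map]

variable {μ : Measure X} {C : ℝ}

theorem LogSobolev.var_le_of_smooth (h : LogSobolev μ C) (hC : 0 ≤ C) {F : X → ℝ}
    (hF : ContDiff ℝ ∞ F) (hFc : HasCompactSupport F) (hF0 : ∀ x, 0 ≤ F x) :
    ∫ x, F x ^ 2 ∂μ - (∫ x, F x ∂μ) ^ 2 ≤ 2 * C * ∫ x, ‖fderiv ℝ F x‖ ^ 2 ∂μ := by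
  have := h.isProbabilityMeasure
  have h0 : 0 ≤ ∫ x, F x ^ 2 ∂μ := integral_nonneg fun _ => sq_nonneg _
  have h1 : 0 ≤ ∫ x, ‖fderiv ℝ F x‖ ^ 2 ∂μ := integral_nonneg fun _ => sq_nonneg _
  rcases h0.eq_or_lt with h0 | h0
  · rw [← h0]
    have := mul_nonneg hC h1
    nlinarith [sq_nonneg (∫ x, F x ∂μ)]
  · refine (sub_sq_le_ent hF.continuous hFc hF0 h0).trans ((h.ineq F hF hFc).trans_eq ?_)
    simp only [norm_gradient_eq]

omit [MeasurableSpace X] [BorelSpace X] in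
theorem exists_smooth_approx {F : X → ℝ} (hF : ContDiff ℝ 1 F) (hFc : HasCompactSupport F)
    (hF0 : ∀ x, 0 ≤ F x) {ε : ℝ} (hε : 0 < ε) :
    ∃ G : X → ℝ, ContDiff ℝ ∞ G ∧ HasCompactSupport G ∧ (∀ x, 0 ≤ G x) ∧
      (∀ x, dist (G x) (F x) ≤ ε) ∧ ∀ x, dist (fderiv ℝ G x) (fderiv ℝ F x) ≤ ε := by
  borelize X
  have hF'c : Continuous (fderiv ℝ F) := hF.continuous_fderiv one_ne_zero
  have u1 := hFc.uniformContinuous_of_continuous hF.continuous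
  have u2 := (hFc.fderiv (𝕜 := ℝ)).uniformContinuous_of_continuous hF'c
  obtain ⟨δ₁, hδ₁, h1⟩ := Metric.uniformContinuous_iff.1 u1 ε hε
  obtain ⟨δ₂, hδ₂, h2⟩ := Metric.uniformContinuous_iff.1 u2 ε hε
  set δ := min δ₁ δ₂
  have hδ : 0 < δ := lt_min hδ₁ hδ₂
  let φ : ContDiffBump (0 : X) := ⟨δ / 2, δ, half_pos hδ, half_lt_self hδ⟩
  let G := convolution (φ.normed volume) F (ContinuousLinearMap.lsmul ℝ ℝ) volume
  have hG' : ∀ x, fderiv ℝ G x =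
      convolution (φ.normed volume) (fderiv ℝ F) (ContinuousLinearMap.lsmul ℝ ℝ) volume x := by
    intro x
    have := (hFc.hasFDerivAt_convolution_right (f := φ.normed volume) (μ := volume)
      (ContinuousLinearMap.lsmul ℝ ℝ)
      φ.continuous_normed.locallyIntegrable hF x)
    rw [this.fderiv, convolution_def, convolution_def]
    rfl
  refine ⟨G, ?_, ?_, ?_, ?_, ?_⟩
  · exact φ.hasCompactSupport_normed.contDiff_convolution_left _ φ.contDiff_normed
      hF.continuous.locallyIntegrable
  · exact φ.hasCompactSupport_normed.convolution _ hFc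
  · intro x
    exact integral_nonneg fun t => mul_nonneg (φ.nonneg_normed t) (hF0 _)
  · intro x
    refine φ.dist_normed_convolution_le hF.continuous.aestronglyMeasurable fun y hy => ?_
    exact (h1 ((Metric.mem_ball.1 hy).trans_le (min_le_left _ _))).le
  · intro x
    rw [hG']
    refine φ.dist_normed_convolution_le hF'c.aestronglyMeasurable fun y hy => ?_
    exact (h2 ((Metric.mem_ball.1 hy).trans_le (min_le_right _ _))).le

/-- Mollification converges uniformly together with the first derivative. -/
theorem LogSobolev.var_le_of_nonneg (h : LogSobolev μ C) (hC : 0 ≤ C) {F : X → ℝ}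
    (hF : ContDiff ℝ 1 F) (hFc : HasCompactSupport F) (hF0 : ∀ x, 0 ≤ F x) :
    ∫ x, F x ^ 2 ∂μ - (∫ x, F x ∂μ) ^ 2 ≤ 2 * C * ∫ x, ‖fderiv ℝ F x‖ ^ 2 ∂μ := by
  have := h.isProbabilityMeasure
  have hε : ∀ n : ℕ, (0 : ℝ) < 1 / (n + 1) := fun n => by positivity
  choose G hG1 hG2 hG3 hG4 hG5 using fun n : ℕ => exists_smooth_approx hF hFc hF0 (hε n)
  obtain ⟨M, hM⟩ := hFc.exists_bound_of_continuous hF.continuous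
  obtain ⟨M', hM'⟩ := (hFc.fderiv (𝕜 := ℝ)).exists_bound_of_continuous
    (hF.continuous_fderiv one_ne_zero)
  have hle : ∀ n : ℕ, (1 : ℝ) / (n + 1) ≤ 1 := fun n => by
    rw [div_le_one (by positivity)]; linarith [n.cast_nonneg (α := ℝ)]
  have hlim : Filter.Tendsto (fun n : ℕ => (1 : ℝ) / (n + 1)) Filter.atTop (nhds 0) :=
    tendsto_one_div_add_atTop_nhds_zero_nat
  refine var_le_of_tendsto (F := G) (G := fun n x => ‖fderiv ℝ (G n) x‖)
    (b := fun _ => M + 1) (c := fun _ => M' + 1)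
    (fun n => (hG1 n).continuous.aestronglyMeasurable)
    (fun n => ((hG1 n).continuous_fderiv (by simp)).norm.aestronglyMeasurable)
    (memLp_const _) (memLp_const _) (fun n x => ?_) (fun n x => ?_) (fun x => ?_) (fun x => ?_)
    fun n => h.var_le_of_smooth hC (hG1 n) (hG2 n) (hG3 n)
  · have h1 := (hG4 n x).trans (hle n)
    rw [Real.dist_eq] at h1
    have h2 := abs_sub_abs_le_abs_sub (G n x) (F x)
    have h3 := hM x
    rw [Real.norm_eq_abs] at h3
    linarith
  · have h1 := (hG5 n x).trans (hle n)
    rw [dist_eq_norm] at h1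
    have h2 := norm_sub_norm_le (fderiv ℝ (G n) x) (fderiv ℝ F x)
    have h3 := hM' x
    rw [abs_norm]
    linarith
  · rw [tendsto_iff_dist_tendsto_zero]
    exact squeeze_zero (fun _ => dist_nonneg) (fun n => hG4 n x) hlim
  · refine Filter.Tendsto.norm ?_
    rw [tendsto_iff_dist_tendsto_zero]
    exact squeeze_zero (fun _ => dist_nonneg) (fun n => hG5 n x) hlim

omit [MeasurableSpace X] [BorelSpace X] in
/-- Smooth cutoff functions with uniformly bounded derivatives. -/
theorem exists_cutoff : ∃ (χ : ℕ → X → ℝ) (c : ℝ), ∀ n, ContDiff ℝ 1 (χ n) ∧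
    HasCompactSupport (χ n) ∧ (∀ x, 0 ≤ χ n x) ∧ (∀ x, χ n x ≤ 1) ∧
    (∀ x, ‖fderiv ℝ (χ n) x‖ ≤ c) ∧ ∀ x ∈ Metric.ball (0 : X) (n + 1), χ n x = 1 := by
  let φ : ContDiffBump (0 : X) := ⟨1, 2, one_pos, one_lt_two⟩
  have hφ : ContDiff ℝ 1 φ := φ.contDiff
  obtain ⟨c, hc⟩ := (φ.hasCompactSupport.fderiv (𝕜 := ℝ)).exists_bound_of_continuous
    (hφ.continuous_fderiv one_ne_zero)
  refine ⟨fun n x => φ ((n + 1 : ℝ)⁻¹ • x), c, fun n => ⟨?_, ?_, fun x => φ.nonneg,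
    fun x => φ.le_one, fun x => ?_, fun x hx => ?_⟩⟩
  · exact hφ.comp (contDiff_const_smul _)
  · exact φ.hasCompactSupport.comp_smul (by positivity)
  · have : HasFDerivAt (fun x : X => φ ((n + 1 : ℝ)⁻¹ • x))
        ((fderiv ℝ φ ((n + 1 : ℝ)⁻¹ • x)).comp ((n + 1 : ℝ)⁻¹ • ContinuousLinearMap.id ℝ X)) x :=
      ((hφ.differentiable one_ne_zero _).hasFDerivAt).comp x
        ((hasFDerivAt_id x).const_smul (n + 1 : ℝ)⁻¹)
    rw [this.fderiv, ContinuousLinearMap.comp_smul, ContinuousLinearMap.comp_id, norm_smul]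
    have h1 := hc ((n + 1 : ℝ)⁻¹ • x)
    have h2 : ‖(n + 1 : ℝ)⁻¹‖ ≤ 1 := by
      rw [norm_inv, Real.norm_of_nonneg (by positivity)]
      exact inv_le_one_of_one_le₀ (by linarith [n.cast_nonneg (α := ℝ)])
    calc _ ≤ 1 * c := by gcongr
      _ = c := one_mul c
  · refine φ.one_of_mem_closedBall ?_
    rw [mem_closedBall_zero_iff, norm_smul, norm_inv, Real.norm_of_nonneg (by positivity)]
    rw [mem_ball_zero_iff] at hx
    change _ ≤ (1 : ℝ)
    rw [inv_mul_le_iff₀ (by positivity)]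
    linarith

/-- The variance ignores constants, so `F + M ≥ 0` replaces `F`; cutoffs then make it compactly
supported, their gradients being uniformly bounded and vanishing near any given point from some
index on. -/
theorem LogSobolev.var_le_of_bounded (h : LogSobolev μ C) (hC : 0 ≤ C) {F : X → ℝ}
    (hF : ContDiff ℝ 1 F) {M : ℝ} (hM : ∀ x, |F x| ≤ M)
    (hF' : MemLp (fun x => ‖fderiv ℝ F x‖) 2 μ) :
    ∫ x, F x ^ 2 ∂μ - (∫ x, F x ∂μ) ^ 2 ≤ 2 * C * ∫ x, ‖fderiv ℝ F x‖ ^ 2 ∂μ := by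
  have := h.isProbabilityMeasure
  obtain ⟨χ, c, hχ⟩ := exists_cutoff (X := X)
  have hM0 : 0 ≤ M := (abs_nonneg _).trans (hM 0)
  have hFM : ContDiff ℝ 1 (fun x => F x + M) := hF.add contDiff_const
  have hFM0 : ∀ x, 0 ≤ F x + M := fun x => by linarith [neg_abs_le (F x), hM x]
  have hFM1 : ∀ x, F x + M ≤ 2 * M := fun x => by linarith [le_abs_self (F x), hM x]
  have hG : ∀ n, ContDiff ℝ 1 (fun x => χ n x * (F x + M)) := fun n => (hχ n).1.mul hFM
  have hev : ∀ x, ∀ᶠ n : ℕ in Filter.atTop,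
      (fun x => χ n x * (F x + M)) =ᶠ[nhds x] fun x => F x + M := by
    intro x
    filter_upwards [Filter.eventually_ge_atTop ⌈‖x‖⌉₊] with n hn
    have hx : x ∈ Metric.ball (0 : X) (n + 1) := by
      rw [mem_ball_zero_iff]
      have := (Nat.le_ceil ‖x‖).trans (Nat.cast_le.2 hn)
      linarith
    filter_upwards [Metric.isOpen_ball.mem_nhds hx] with y hy
    rw [(hχ n).2.2.2.2.2 y hy, one_mul]
  have hFM' : ∀ x, fderiv ℝ (fun x => F x + M) x = fderiv ℝ F x := fun x => fderiv_add_const M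
  have key := var_le_of_tendsto (μ := μ) (F := fun n x => χ n x * (F x + M))
    (G := fun n x => ‖fderiv ℝ (fun x => χ n x * (F x + M)) x‖)
    (f := fun x => F x + M) (g := fun x => ‖fderiv ℝ F x‖)
    (b := fun _ => 2 * M) (c := fun x => ‖fderiv ℝ F x‖ + 2 * M * c)
    (fun n => (hG n).continuous.aestronglyMeasurable)
    (fun n => ((hG n).continuous_fderiv one_ne_zero).norm.aestronglyMeasurable)
    (memLp_const _) (hF'.add (memLp_const _)) (fun n x => ?_) (fun n x => ?_) (fun x => ?_)
    (fun x => ?_) (fun n => h.var_le_of_nonneg hC (hG n) (hχ n).2.1.mul_right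
      fun x => mul_nonneg ((hχ n).2.2.1 x) (hFM0 x))
  · have hFi : Integrable F μ := (integrable_const M).mono' hF.continuous.aestronglyMeasurable
      (.of_forall hM)
    have hF2 : Integrable (fun x => F x ^ 2) μ := by
      refine (integrable_const (M ^ 2)).mono' (hF.continuous.pow 2).aestronglyMeasurable
        (.of_forall fun x => ?_)
      rw [Real.norm_of_nonneg (sq_nonneg _), ← sq_abs]
      have := hM x
      gcongr
    have e1 : ∫ x, (F x + M) ∂μ = ∫ x, F x ∂μ + M := by
      rw [integral_add hFi (integrable_const _)]; simp
    have e2 : ∫ x, (F x + M) ^ 2 ∂μ = ∫ x, F x ^ 2 ∂μ + 2 * M * ∫ x, F x ∂μ + M ^ 2 := by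
      have : ∀ x, (F x + M) ^ 2 = F x ^ 2 + 2 * M * F x + M ^ 2 := fun x => by ring
      simp only [this]
      have hI : Integrable (fun x => F x ^ 2 + 2 * M * F x) μ := hF2.add (hFi.const_mul _)
      rw [integral_add hI (integrable_const _), integral_add hF2 (hFi.const_mul _),
        integral_const_mul]
      simp
    rw [e1, e2] at key
    linarith
  · rw [abs_of_nonneg (mul_nonneg ((hχ n).2.2.1 x) (hFM0 x))]
    nlinarith [(hχ n).2.2.2.1 x, hFM0 x, hFM1 x]
  · rw [abs_norm, fderiv_fun_mul ((hχ n).1.differentiable one_ne_zero x)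
      (hFM.differentiable one_ne_zero x), hFM']
    refine (norm_add_le _ _).trans ?_
    rw [norm_smul, norm_smul, Real.norm_of_nonneg ((hχ n).2.2.1 x),
      Real.norm_of_nonneg (hFM0 x)]
    have h1 := (hχ n).2.2.2.1 x
    have h2 := (hχ n).2.2.2.2.1 x
    have h3 := hFM1 x
    calc χ n x * ‖fderiv ℝ F x‖ + (F x + M) * ‖fderiv ℝ (χ n) x‖
        ≤ 1 * ‖fderiv ℝ F x‖ + 2 * M * c := by gcongr
      _ = _ := by rw [one_mul]
  · refine tendsto_const_nhds.congr' ?_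
    filter_upwards [hev x] with n hn using hn.eq_of_nhds.symm
  · refine tendsto_const_nhds.congr' ?_
    filter_upwards [hev x] with n hn
    rw [hn.fderiv_eq, hFM']

end Poincare

/-! ### Poincaré for square-integrable functions, and exponential moments. -/

section Moments

/-- A smooth truncation of the identity. -/
def trunc (n : ℕ) (t : ℝ) : ℝ := (n + 1) * Real.sin (t / (n + 1))

theorem abs_trunc_le (n : ℕ) (t : ℝ) : |trunc n t| ≤ |t| := by
  have hn : (0 : ℝ) < n + 1 := by positivity
  rw [trunc, abs_mul, abs_of_pos hn]
  calc (n + 1 : ℝ) * |Real.sin (t / (n + 1))| ≤ (n + 1) * |t / (n + 1)| :=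
        mul_le_mul_of_nonneg_left Real.abs_sin_le_abs hn.le
    _ = |t| := by rw [abs_div, abs_of_pos hn]; field_simp

theorem abs_trunc_le_const (n : ℕ) (t : ℝ) : |trunc n t| ≤ n + 1 := by
  have hn : (0 : ℝ) < n + 1 := by positivity
  rw [trunc, abs_mul, abs_of_pos hn]
  exact mul_le_of_le_one_right hn.le (Real.abs_sin_le_one _)

theorem hasDerivAt_trunc (n : ℕ) (t : ℝ) : HasDerivAt (trunc n) (Real.cos (t / (n + 1))) t := by
  have hn : (n + 1 : ℝ) ≠ 0 := by positivity
  have := (((hasDerivAt_id t).div_const (n + 1 : ℝ)).sin).const_mul (n + 1 : ℝ)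
  refine this.congr_deriv ?_
  simp only [id]
  field_simp

theorem contDiff_trunc (n : ℕ) : ContDiff ℝ 1 (trunc n) :=
  contDiff_const.mul (Real.contDiff_sin.comp (contDiff_id.div_const _))

theorem tendsto_div_nat_succ (t : ℝ) :
    Filter.Tendsto (fun n : ℕ => t / (n + 1 : ℝ)) Filter.atTop (nhds 0) := by
  simpa [div_eq_mul_inv] using
    (tendsto_one_div_add_atTop_nhds_zero_nat (𝕜 := ℝ)).const_mul t

theorem tendsto_trunc (t : ℝ) : Filter.Tendsto (fun n => trunc n t) Filter.atTop (nhds t) := by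
  have h := (Real.hasDerivAt_sin 0).hasFDerivAt.lim (c := fun n : ℕ => (n + 1 : ℝ))
    (l := Filter.atTop) t ?_
  · simpa [trunc, div_eq_inv_mul] using h
  · refine Filter.tendsto_atTop_mono (fun n => ?_) tendsto_natCast_atTop_atTop
    rw [Real.norm_of_nonneg (by positivity)]
    linarith

variable {X : Type*} [MeasurableSpace X] [NormedAddCommGroup X] [InnerProductSpace ℝ X]

omit [MeasurableSpace X] in
theorem fderiv_trunc_comp {F : X → ℝ} (hF : ContDiff ℝ 1 F) (n : ℕ) (x : X) :
    fderiv ℝ (fun x => trunc n (F x)) x = Real.cos (F x / (n + 1)) • fderiv ℝ F x :=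
  ((hasDerivAt_trunc n (F x)).comp_hasFDerivAt x
    (hF.differentiable one_ne_zero x).hasFDerivAt).fderiv

variable [FiniteDimensional ℝ X] [BorelSpace X] {μ : Measure X} {C : ℝ}

/-- The Poincaré inequality implied by the log-Sobolev inequality. -/
theorem LogSobolev.var_le (h : LogSobolev μ C) (hC : 0 ≤ C) {F : X → ℝ}
    (hF : ContDiff ℝ 1 F) (hF2 : MemLp F 2 μ) (hF' : MemLp (fun x => ‖fderiv ℝ F x‖) 2 μ) :
    ∫ x, F x ^ 2 ∂μ - (∫ x, F x ∂μ) ^ 2 ≤ 2 * C * ∫ x, ‖fderiv ℝ F x‖ ^ 2 ∂μ := by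
  have := h.isProbabilityMeasure
  have hG : ∀ n, ContDiff ℝ 1 (fun x => trunc n (F x)) := fun n => (contDiff_trunc n).comp hF
  have hle : ∀ n x, ‖fderiv ℝ (fun x => trunc n (F x)) x‖ ≤ ‖fderiv ℝ F x‖ := by
    intro n x
    rw [fderiv_trunc_comp hF, norm_smul]
    exact mul_le_of_le_one_left (norm_nonneg _) (Real.abs_cos_le_one _)
  have hm : ∀ n, AEStronglyMeasurable (fun x => ‖fderiv ℝ (fun x => trunc n (F x)) x‖) μ :=
    fun n => ((hG n).continuous_fderiv one_ne_zero).norm.aestronglyMeasurable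
  refine var_le_of_tendsto (μ := μ) (F := fun n x => trunc n (F x))
    (G := fun n x => ‖fderiv ℝ (fun x => trunc n (F x)) x‖) (b := fun x => |F x|)
    (c := fun x => ‖fderiv ℝ F x‖) (fun n => (hG n).continuous.aestronglyMeasurable) hm
    hF2.abs hF' (fun n x => abs_trunc_le n _) (fun n x => by rw [abs_norm]; exact hle n x)
    (fun x => tendsto_trunc _) (fun x => ?_)
    fun n => h.var_le_of_bounded hC (hG n) (fun x => abs_trunc_le_const n _)
      (hF'.mono (hm n) (.of_forall fun x => by rw [norm_norm, norm_norm]; exact hle n x))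
  simp only [fderiv_trunc_comp hF]
  have h1 : Filter.Tendsto (fun n : ℕ => Real.cos (F x / (n + 1))) Filter.atTop (nhds 1) := by
    have := (Real.continuous_cos.tendsto 0).comp (tendsto_div_nat_succ (F x))
    rwa [Real.cos_zero] at this
  simpa using (h1.smul_const (fderiv ℝ F x)).norm

/-- A smooth substitute for the norm. -/
def japanese (x : X) : ℝ := √(1 + ‖x‖ ^ 2)

omit [MeasurableSpace X] [FiniteDimensional ℝ X] [BorelSpace X] [InnerProductSpace ℝ X] in
theorem norm_le_japanese (x : X) : ‖x‖ ≤ japanese x :=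
  Real.le_sqrt_of_sq_le (by linarith)

omit [MeasurableSpace X] [FiniteDimensional ℝ X] [BorelSpace X] in
theorem contDiff_japanese : ContDiff ℝ 1 (japanese : X → ℝ) :=
  (contDiff_const.add (contDiff_id.norm_sq ℝ)).sqrt fun x => by positivity

omit [MeasurableSpace X] [FiniteDimensional ℝ X] [BorelSpace X] in
theorem norm_fderiv_japanese_le (x : X) : ‖fderiv ℝ (japanese : X → ℝ) x‖ ≤ 1 := by
  have h0 : (1 + ‖x‖ ^ 2 : ℝ) ≠ 0 := by positivity
  have h2 : HasFDerivAt (fun x : X => ‖x‖ ^ 2) (2 • (innerSL ℝ x : X →L[ℝ] ℝ)) x := by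
    have := (hasFDerivAt_id x).norm_sq
    simpa using this
  have h3 : HasFDerivAt (japanese : X → ℝ) _ x := (h2.const_add 1).sqrt h0
  rw [h3.fderiv]
  refine ContinuousLinearMap.opNorm_le_bound _ zero_le_one fun v => ?_
  have hs : 0 < √(1 + ‖x‖ ^ 2) := Real.sqrt_pos.2 (by positivity)
  have e : ((1 / (2 * √(1 + ‖x‖ ^ 2))) • (2 • (innerSL ℝ x : X →L[ℝ] ℝ))) v
      = inner ℝ x v / √(1 + ‖x‖ ^ 2) := by
    simp
    field_simp
  rw [e, norm_div, Real.norm_of_nonneg hs.le, div_le_iff₀ hs, one_mul, mul_comm]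
  exact (norm_inner_le_norm x v).trans
    (mul_le_mul_of_nonneg_right (norm_le_japanese x) (norm_nonneg v))

omit [NormedAddCommGroup X] [InnerProductSpace ℝ X] [FiniteDimensional ℝ X] [BorelSpace X] in
theorem sq_integral_mul_le {f g : X → ℝ} (hf : MemLp f 2 μ) (hg : MemLp g 2 μ) :
    (∫ x, f x * g x ∂μ) ^ 2 ≤ (∫ x, f x ^ 2 ∂μ) * ∫ x, g x ^ 2 ∂μ := by
  have hf2 := hf.integrable_sq
  have hg2 := hg.integrable_sq
  have hfg : Integrable (fun x => f x * g x) μ := hf.integrable_mul hg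
  have key : ∀ t : ℝ, 0 ≤ (∫ x, f x ^ 2 ∂μ) * (t * t) + (2 * ∫ x, f x * g x ∂μ) * t
      + ∫ x, g x ^ 2 ∂μ := by
    intro t
    have h0 : 0 ≤ ∫ x, (t * f x + g x) ^ 2 ∂μ := integral_nonneg fun _ => sq_nonneg _
    have e : ∀ x, (t * f x + g x) ^ 2 = t * t * f x ^ 2 + 2 * t * (f x * g x) + g x ^ 2 :=
      fun x => by ring
    simp only [e] at h0
    have hI : Integrable (fun x => t * t * f x ^ 2 + 2 * t * (f x * g x)) μ :=
      (hf2.const_mul _).add (hfg.const_mul _)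
    rw [integral_add hI hg2, integral_add (hf2.const_mul _) (hfg.const_mul _),
      integral_const_mul, integral_const_mul] at h0
    linarith
  have := discrim_le_zero key
  rw [discrim] at this
  nlinarith

omit [FiniteDimensional ℝ X] in
theorem exists_measureReal_norm_gt_le (μ : Measure X) [IsProbabilityMeasure μ] {δ : ℝ}
    (hδ : 0 < δ) : ∃ R : ℝ, μ.real {x | R < japanese x} ≤ δ := by
  have hmeas : ∀ n : ℕ, MeasurableSet {x : X | (n : ℝ) < japanese x} := fun n =>
    (isOpen_lt continuous_const contDiff_japanese.continuous).measurableSet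
  have h := tendsto_measure_iInter_atTop (μ := μ) (s := fun n : ℕ => {x : X | (n : ℝ) < japanese x})
    (fun n => (hmeas n).nullMeasurableSet)
    (fun m n hmn x (hx : (n : ℝ) < japanese x) =>
      show (m : ℝ) < japanese x from (Nat.cast_le.2 hmn).trans_lt hx) ⟨0, measure_ne_top _ _⟩
  have he : ⋂ n : ℕ, {x : X | (n : ℝ) < japanese x} = ∅ := by
    refine Set.eq_empty_of_forall_notMem fun x hx => ?_
    obtain ⟨n, hn⟩ := exists_nat_ge (japanese x)
    exact absurd (Set.mem_iInter.1 hx n) (not_lt.2 hn)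
  rw [he, measure_empty] at h
  obtain ⟨n, hn⟩ := (h.eventually (Iic_mem_nhds (ENNReal.ofReal_pos.2 hδ))).exists
  exact ⟨n, ENNReal.toReal_le_of_le_ofReal hδ.le hn⟩

/-- Exponential integrability of the norm under a log-Sobolev inequality. -/
theorem LogSobolev.exists_integrable_exp (h : LogSobolev μ C) (hC : 0 < C) :
    ∃ l > 0, Integrable (fun x => Real.exp (l * ‖x‖)) μ := by
  have := h.isProbabilityMeasure
  obtain ⟨R, hR⟩ := exists_measureReal_norm_gt_le μ (by norm_num : (0 : ℝ) < 1 / 8)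
  -- Chosen so that the Poincaré term `2C (l/2)² a` is `a/4`.
  set l := √(1 / (2 * C)) with hl_def
  have hl : 0 < l := Real.sqrt_pos.2 (by positivity)
  have hl2 : l ^ 2 * (2 * C) = 1 := by
    rw [hl_def, Real.sq_sqrt (by positivity)]; field_simp
  set S : Set X := {x | R < japanese x}
  have hS : MeasurableSet S :=
    (isOpen_lt continuous_const contDiff_japanese.continuous).measurableSet
  set u : ℕ → X → ℝ := fun n x => Real.exp (l / 2 * trunc n (japanese x)) with hu_def
  have hu1 : ∀ n, ContDiff ℝ 1 (u n) := fun n =>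
    Real.contDiff_exp.comp (contDiff_const.mul ((contDiff_trunc n).comp contDiff_japanese))
  have hub : ∀ n x, |u n x| ≤ Real.exp (l / 2 * (n + 1)) := fun n x => by
    rw [Real.abs_exp, Real.exp_le_exp]
    gcongr
    exact (le_abs_self _).trans (abs_trunc_le_const n _)
  have hu' : ∀ n x, ‖fderiv ℝ (u n) x‖ ≤ l / 2 * u n x := by
    intro n x
    have h1 : HasFDerivAt (fun x : X => trunc n (japanese x)) _ x :=
      (((contDiff_trunc n).comp contDiff_japanese).differentiable one_ne_zero x).hasFDerivAt
    have h2 := (h1.const_mul (l / 2)).exp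
    rw [(h2 : HasFDerivAt (u n) _ x).fderiv, norm_smul, norm_smul,
      Real.norm_of_nonneg (Real.exp_pos _).le, Real.norm_of_nonneg (by positivity : 0 ≤ l / 2)]
    have h3 : ‖fderiv ℝ (trunc n ∘ japanese) x‖ ≤ 1 := by
      change ‖fderiv ℝ (fun x => trunc n (japanese x)) x‖ ≤ 1
      rw [fderiv_trunc_comp contDiff_japanese, norm_smul]
      exact mul_le_one₀ (Real.abs_cos_le_one _) (norm_nonneg _) (norm_fderiv_japanese_le x)
    have h4 : 0 ≤ u n x := (Real.exp_pos _).le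
    calc u n x * (l / 2 * ‖fderiv ℝ (trunc n ∘ japanese) x‖) ≤ u n x * (l / 2 * 1) := by gcongr
      _ = l / 2 * u n x := by ring
  have huL : ∀ n, MemLp (u n) 2 μ := fun n =>
    MemLp.of_bound (hu1 n).continuous.aestronglyMeasurable _ (.of_forall (hub n))
  have hu'L : ∀ n, MemLp (fun x => ‖fderiv ℝ (u n) x‖) 2 μ := fun n =>
    ((huL n).const_mul (l / 2)).mono'
      ((hu1 n).continuous_fderiv one_ne_zero).norm.aestronglyMeasurable
      (.of_forall fun x => by rw [norm_norm]; exact hu' n x)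
  -- Splitting the mean of `u n` at radius `R`, with Cauchy–Schwarz on the tail of mass at most
  -- `1/8`, gives `a ≤ 2 exp (l R) + a/4 + a/4`. Truncation makes `a` finite, so it can be absorbed.
  have hmain : ∀ n, ∫ x, u n x ^ 2 ∂μ ≤ 4 * Real.exp (l * R) := by
    intro n
    set a := ∫ x, u n x ^ 2 ∂μ
    have h1 := h.var_le hC.le (hu1 n) (huL n) (hu'L n)
    have h2 : ∫ x, ‖fderiv ℝ (u n) x‖ ^ 2 ∂μ ≤ (l / 2) ^ 2 * a := by
      rw [← integral_const_mul]
      refine integral_mono (hu'L n).integrable_sq ((huL n).integrable_sq.const_mul _) fun x => ?_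
      change ‖fderiv ℝ (u n) x‖ ^ 2 ≤ (l / 2) ^ 2 * u n x ^ 2
      rw [← mul_pow]
      have := hu' n x
      gcongr
    have h3 : ∫ x, u n x ∂μ ≤ Real.exp (l / 2 * R) + ∫ x, S.indicator 1 x * u n x ∂μ := by
      have hI : Integrable (fun x => S.indicator 1 x * u n x) μ := by
        have := ((huL n).integrable (by norm_num)).indicator hS
        refine this.congr (.of_forall fun x => ?_)
        by_cases hx : x ∈ S <;> simp [hx]
      have e : Real.exp (l / 2 * R) + ∫ x, S.indicator 1 x * u n x ∂μ
          = ∫ x, (Real.exp (l / 2 * R) + S.indicator 1 x * u n x) ∂μ := by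
        rw [integral_add (integrable_const _) hI]; simp
      rw [e]
      refine integral_mono ((huL n).integrable (by norm_num)) ((integrable_const _).add hI)
        fun x => ?_
      by_cases hx : x ∈ S
      · simp only [hx, Set.indicator_of_mem, Pi.one_apply, one_mul]
        linarith [Real.exp_pos (l / 2 * R)]
      · simp only [hx, not_false_eq_true, Set.indicator_of_notMem, zero_mul, add_zero]
        rw [hu_def, Real.exp_le_exp]
        have h4 : trunc n (japanese x) ≤ R := by
          refine (le_abs_self _).trans ((abs_trunc_le n _).trans ?_)
          rw [abs_of_nonneg (a := japanese x) (Real.sqrt_nonneg _)]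
          exact not_lt.1 hx
        gcongr
    have h4 : (∫ x, S.indicator 1 x * u n x ∂μ) ^ 2 ≤ 1 / 8 * a := by
      have hi : MemLp (S.indicator (1 : X → ℝ)) 2 μ := (memLp_const 1).indicator hS
      refine (sq_integral_mul_le hi (huL n)).trans ?_
      have e : ∫ x, (S.indicator (1 : X → ℝ) x) ^ 2 ∂μ = μ.real S := by
        rw [← integral_indicator_one hS]
        refine integral_congr_ae (.of_forall fun x => ?_)
        by_cases hx : x ∈ S <;> simp [hx]
      rw [e]
      have : 0 ≤ a := integral_nonneg fun _ => sq_nonneg _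
      gcongr
    have h5 : Real.exp (l / 2 * R) ^ 2 = Real.exp (l * R) := by
      rw [← Real.exp_nat_mul]; congr 1; push_cast; ring
    have h6 : 0 ≤ ∫ x, u n x ∂μ := integral_nonneg fun x => (Real.exp_pos _).le
    set b := ∫ x, u n x ∂μ
    set q := ∫ x, S.indicator 1 x * u n x ∂μ
    set E := Real.exp (l / 2 * R)
    have h7 : b ^ 2 ≤ (E + q) ^ 2 := by gcongr
    have h8 : 2 * C * ∫ x, ‖fderiv ℝ (u n) x‖ ^ 2 ∂μ ≤ a / 4 := by
      calc _ ≤ 2 * C * ((l / 2) ^ 2 * a) := by gcongr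
        _ = (l ^ 2 * (2 * C)) * a / 4 := by ring
        _ = a / 4 := by rw [hl2, one_mul]
    nlinarith [sq_nonneg (E - q)]
  refine ⟨l, hl, ?_⟩
  have hlim : ∀ x, Filter.Tendsto (fun n => u n x ^ 2) Filter.atTop
      (nhds (Real.exp (l / 2 * japanese x) ^ 2)) := fun x =>
    (((Real.continuous_exp.tendsto _).comp ((tendsto_trunc (japanese x)).const_mul (l / 2)))).pow 2
  have hfin : ∫⁻ x, ‖Real.exp (l / 2 * japanese x) ^ 2‖ₑ ∂μ < ⊤ := by
    refine lt_of_le_of_lt ?_ (ENNReal.ofReal_lt_top (r := 4 * Real.exp (l * R)))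
    calc ∫⁻ x, ‖Real.exp (l / 2 * japanese x) ^ 2‖ₑ ∂μ
        = ∫⁻ x, Filter.liminf (fun n => ‖u n x ^ 2‖ₑ) Filter.atTop ∂μ := by
          refine lintegral_congr fun x => ?_
          exact ((hlim x).enorm.liminf_eq).symm
      _ ≤ Filter.liminf (fun n => ∫⁻ x, ‖u n x ^ 2‖ₑ ∂μ) Filter.atTop :=
          lintegral_liminf_le fun n => ((hu1 n).continuous.pow 2).measurable.enorm
      _ ≤ ENNReal.ofReal (4 * Real.exp (l * R)) := by
          refine Filter.liminf_le_of_le (by isBoundedDefault) fun b hb => ?_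
          obtain ⟨n, hn⟩ := hb.exists
          refine hn.trans ?_
          have e : ∫⁻ x, ‖u n x ^ 2‖ₑ ∂μ = ENNReal.ofReal (∫ x, u n x ^ 2 ∂μ) := by
            rw [ofReal_integral_eq_lintegral_ofReal (huL n).integrable_sq
              (.of_forall fun _ => sq_nonneg _)]
            refine lintegral_congr fun x => ?_
            rw [Real.enorm_of_nonneg (sq_nonneg _)]
          rw [e]
          exact ENNReal.ofReal_le_ofReal (hmain n)
  have hI : Integrable (fun x : X => Real.exp (l / 2 * japanese x) ^ 2) μ :=
    ⟨((Real.continuous_exp.comp (continuous_const.mul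
      contDiff_japanese.continuous)).pow 2).aestronglyMeasurable, hfin⟩
  refine hI.mono' (by fun_prop) (.of_forall fun x => ?_)
  rw [Real.norm_of_nonneg (Real.exp_pos _).le, ← Real.exp_nat_mul, Real.exp_le_exp]
  push_cast
  nlinarith [norm_le_japanese x]

end Moments

/-! ### Tilts by functions with small Lipschitz constant. -/

section Tilt

variable {X : Type*} [MeasurableSpace X] [NormedAddCommGroup X]

/-- Convexity of `exp` between `0` and `l * r`: a weak exponential is controlled by a small multiple
of one fixed exponential. -/
theorem exp_mul_le_one_add {l L r : ℝ} (hl : 0 < l) (hL : 0 ≤ L) (hLl : L ≤ l) :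
    Real.exp (L * r) ≤ 1 + L / l * Real.exp (l * r) := by
  have h0 : 0 ≤ L / l := by positivity
  have h1 : L / l ≤ 1 := (div_le_one hl).2 hLl
  have := convexOn_exp.2 (Set.mem_univ 0) (Set.mem_univ (l * r)) (sub_nonneg.2 h1) h0 (by ring)
  simp only [smul_eq_mul, mul_zero, zero_add, Real.exp_zero, mul_one] at this
  have e : L / l * (l * r) = L * r := by field_simp
  rw [e] at this
  linarith

theorem one_sub_le_exp_neg_mul {l L r : ℝ} (hl : 0 < l) (hL : 0 ≤ L) :
    1 - L / l * Real.exp (l * r) ≤ Real.exp (-(L * r)) := by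
  have h0 : 0 ≤ L / l := by positivity
  have h1 := Real.add_one_le_exp (-(L * r))
  have h2 : L * r ≤ L / l * Real.exp (l * r) := by
    have e : L * r = L / l * (l * r) := by field_simp
    rw [e]
    gcongr
    linarith [Real.add_one_le_exp (l * r)]
  linarith

variable [BorelSpace X] {ν : Measure X} [IsProbabilityMeasure ν]

omit [IsProbabilityMeasure ν] in
theorem memLp_exp_of_lipschitz {u : X → ℝ} (hu : Continuous u) {l L : ℝ}
    (hl : Integrable (fun x => Real.exp (l * ‖x‖)) ν) (hL : 2 * L ≤ l)
    (huL : ∀ x y, |u x - u y| ≤ L * ‖x - y‖) : MemLp (fun x => Real.exp (u x)) 2 ν := by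
  refine (memLp_two_iff_integrable_sq (Real.continuous_exp.comp hu).aestronglyMeasurable).2 ?_
  refine (hl.const_mul (Real.exp (2 * u 0))).mono'
    ((Real.continuous_exp.comp hu).pow 2).aestronglyMeasurable (.of_forall fun x => ?_)
  rw [Real.norm_of_nonneg (sq_nonneg _), Function.comp_apply, ← Real.exp_nat_mul, ← Real.exp_add,
    Real.exp_le_exp]
  have h1 := (le_abs_self _).trans (huL x 0)
  rw [sub_zero] at h1
  push_cast
  nlinarith [norm_nonneg x]

/-- The density of a tilt by a function with a small Lipschitz constant has a bounded second
moment. -/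
theorem integral_exp_two_le {u : X → ℝ} (hu : Continuous u) {l L : ℝ} (hl0 : 0 < l) (hL0 : 0 ≤ L)
    (hl : Integrable (fun x => Real.exp (l * ‖x‖)) ν)
    (hL : 4 * L * ∫ x, Real.exp (l * ‖x‖) ∂ν ≤ l)
    (huL : ∀ x y, |u x - u y| ≤ L * ‖x - y‖) :
    ∫ x, Real.exp (u x) ^ 2 ∂ν ≤ 4 * (∫ x, Real.exp (u x) ∂ν) ^ 2 := by
  set Λ := ∫ x, Real.exp (l * ‖x‖) ∂ν with hΛ
  have hΛ1 : 1 ≤ Λ := by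
    have : ∫ _, (1 : ℝ) ∂ν ≤ Λ := integral_mono (integrable_const _) hl fun x =>
      Real.one_le_exp (by positivity)
    simpa using this
  have hLl : 2 * L ≤ l := by nlinarith
  have hm := memLp_exp_of_lipschitz hu hl hLl huL
  have hLΛ : L / l * Λ ≤ 1 / 4 := by
    rw [div_mul_eq_mul_div, div_le_iff₀ hl0]; linarith
  -- As `L Λ / l ≤ 1/4`, the second moment is at most `3/2` and the mean at least `3/4`, in units of
  -- `exp (u 0)`; the ratio `(3/2) / (3/4)² = 8/3` is below `4`.
  have h1 : ∫ x, Real.exp (u x) ^ 2 ∂ν ≤ Real.exp (u 0) ^ 2 * (3 / 2) := by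
    have : ∫ x, Real.exp (u x) ^ 2 ∂ν
        ≤ ∫ x, Real.exp (u 0) ^ 2 * (1 + 2 * L / l * Real.exp (l * ‖x‖)) ∂ν := by
      refine integral_mono hm.integrable_sq
        (((integrable_const _).add (hl.const_mul _)).const_mul _) fun x => ?_
      have h2 := (le_abs_self _).trans (huL x 0)
      rw [sub_zero] at h2
      have h3 := exp_mul_le_one_add (r := ‖x‖) hl0 (by positivity : 0 ≤ 2 * L) hLl
      calc Real.exp (u x) ^ 2 = Real.exp (u 0) ^ 2 * Real.exp (2 * (u x - u 0)) := by
            rw [← Real.exp_nat_mul, ← Real.exp_nat_mul, ← Real.exp_add]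
            congr 1; push_cast; ring
        _ ≤ Real.exp (u 0) ^ 2 * Real.exp (2 * L * ‖x‖) := by
            gcongr _ * Real.exp ?_
            linarith
        _ ≤ _ := by gcongr
    refine this.trans ?_
    rw [integral_const_mul, integral_add (integrable_const _) (hl.const_mul _), integral_const_mul]
    simp only [integral_const, probReal_univ, one_smul]
    gcongr
    rw [← hΛ]
    have : 2 * L / l * Λ = 2 * (L / l * Λ) := by ring
    linarith
  have h2 : Real.exp (u 0) * (3 / 4) ≤ ∫ x, Real.exp (u x) ∂ν := by
    have : ∫ x, Real.exp (u 0) * (1 - L / l * Real.exp (l * ‖x‖)) ∂ν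
        ≤ ∫ x, Real.exp (u x) ∂ν := by
      refine integral_mono (((integrable_const _).sub (hl.const_mul _)).const_mul _)
        (hm.integrable (by norm_num)) fun x => ?_
      have h2 := (neg_abs_le _).trans' (neg_le_neg (huL x 0))
      rw [sub_zero] at h2
      have h3 := one_sub_le_exp_neg_mul (r := ‖x‖) hl0 hL0
      calc Real.exp (u 0) * (1 - L / l * Real.exp (l * ‖x‖))
          ≤ Real.exp (u 0) * Real.exp (-(L * ‖x‖)) := by gcongr
        _ = Real.exp (u 0 - L * ‖x‖) := by rw [← Real.exp_add]; rfl
        _ ≤ Real.exp (u x) := by gcongr; linarith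
    refine le_trans ?_ this
    rw [integral_const_mul, integral_sub (integrable_const _) (hl.const_mul _), integral_const_mul]
    simp only [integral_const, probReal_univ, one_smul]
    gcongr
    rw [← hΛ]
    linarith
  have h3 : (Real.exp (u 0) * (3 / 4)) ^ 2 ≤ (∫ x, Real.exp (u x) ∂ν) ^ 2 := by gcongr
  nlinarith [sq_nonneg (Real.exp (u 0))]

variable [InnerProductSpace ℝ X] [FiniteDimensional ℝ X] {C : ℝ}

omit [IsProbabilityMeasure ν] in
/-- Sensitivity of expectations to a tilt by a function with a small Lipschitz constant. -/
theorem LogSobolev.abs_integral_sub_tilted_le (h : LogSobolev ν C) (hC : 0 ≤ C) {u : X → ℝ}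
    (hu : ContDiff ℝ 1 u) {l L : ℝ} (hl0 : 0 < l) (hL0 : 0 ≤ L)
    (hl : Integrable (fun x => Real.exp (l * ‖x‖)) ν)
    (hL : 4 * L * ∫ x, Real.exp (l * ‖x‖) ∂ν ≤ l)
    (huL : ∀ x y, |u x - u y| ≤ L * ‖x - y‖) {Φ : X → ℝ} (hΦ : ContDiff ℝ 1 Φ)
    (hΦ2 : MemLp Φ 2 ν) (hΦ' : MemLp (fun x => ‖fderiv ℝ Φ x‖) 2 ν) :
    |∫ x, Φ x ∂ν - ∫ x, Φ x ∂(ν.tilted u)| ≤ 4 * C * L * √(∫ x, ‖fderiv ℝ Φ x‖ ^ 2 ∂ν) := by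
  have := h.isProbabilityMeasure
  have hΛ1 : 1 ≤ ∫ x, Real.exp (l * ‖x‖) ∂ν := by
    have : ∫ _, (1 : ℝ) ∂ν ≤ ∫ x, Real.exp (l * ‖x‖) ∂ν :=
      integral_mono (integrable_const _) hl fun x => Real.one_le_exp (by positivity)
    simpa using this
  have hLl : 2 * L ≤ l := by nlinarith
  have hm := memLp_exp_of_lipschitz hu.continuous hl hLl huL
  have h2 := integral_exp_two_le hu.continuous hl0 hL0 hl hL huL
  set Z := ∫ x, Real.exp (u x) ∂ν with hZ
  have hZ0 : 0 < Z := integral_exp_pos (hm.integrable (by norm_num))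
  -- The density of the tilt. Its gradient is `ρ ∇u`, so `E ρ² ≤ 4` bounds `E‖∇ρ‖²` by `4L²`.
  set ρ : X → ℝ := fun x => Real.exp (u x) / Z with hρ
  have hρ1 : ContDiff ℝ 1 ρ := (Real.contDiff_exp.comp hu).div_const _
  have hρ2 : MemLp ρ 2 ν := by
    have := hm.mul_const Z⁻¹
    simpa only [hρ, div_eq_mul_inv] using this
  have hρi : ∫ x, ρ x ∂ν = 1 := by
    rw [hρ, integral_div, ← hZ, div_self hZ0.ne']
  have hρsq : ∫ x, ρ x ^ 2 ∂ν ≤ 4 := by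
    simp only [hρ, div_pow]
    rw [integral_div, div_le_iff₀ (by positivity)]
    exact h2
  have hρ' : ∀ x, ‖fderiv ℝ ρ x‖ ≤ L * ρ x := by
    intro x
    have h1 : HasFDerivAt ρ (Z⁻¹ • (Real.exp (u x) • fderiv ℝ u x)) x := by
      simpa only [hρ, div_eq_mul_inv] using
        ((hu.differentiable one_ne_zero x).hasFDerivAt.exp).mul_const Z⁻¹
    have h3 : ‖fderiv ℝ u x‖ ≤ L := by
      refine norm_fderiv_le_of_lip' ℝ hL0 (.of_forall fun y => ?_)
      exact huL y x
    rw [h1.fderiv, norm_smul, norm_smul, Real.norm_of_nonneg (Real.exp_pos _).le,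
      Real.norm_of_nonneg (inv_nonneg.2 hZ0.le), ← mul_assoc, mul_comm L]
    simp only [hρ, div_eq_inv_mul]
    gcongr
  have hρ'm : MemLp (fun x => ‖fderiv ℝ ρ x‖) 2 ν :=
    (hρ2.const_mul L).mono' (hρ1.continuous_fderiv one_ne_zero).norm.aestronglyMeasurable
      (.of_forall fun x => by rw [norm_norm]; exact hρ' x)
  have hρ'sq : ∫ x, ‖fderiv ℝ ρ x‖ ^ 2 ∂ν ≤ L ^ 2 * 4 := by
    have : ∫ x, ‖fderiv ℝ ρ x‖ ^ 2 ∂ν ≤ L ^ 2 * ∫ x, ρ x ^ 2 ∂ν := by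
      rw [← integral_const_mul]
      refine integral_mono hρ'm.integrable_sq (hρ2.integrable_sq.const_mul _) fun x => ?_
      change ‖fderiv ℝ ρ x‖ ^ 2 ≤ L ^ 2 * ρ x ^ 2
      rw [← mul_pow]
      have := hρ' x
      gcongr
    refine this.trans ?_
    gcongr
  set m := ∫ x, Φ x ∂ν with hm_def
  have hΦi : Integrable Φ ν := hΦ2.integrable (by norm_num)
  have hρint : Integrable ρ ν := hρ2.integrable (by norm_num)
  have hΦρ : Integrable (fun x => Φ x * ρ x) ν := hΦ2.integrable_mul hρ2
  have hvar : ∀ {F : X → ℝ}, MemLp F 2 ν → ∫ x, (F x - ∫ y, F y ∂ν) ^ 2 ∂ν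
      = ∫ x, F x ^ 2 ∂ν - (∫ x, F x ∂ν) ^ 2 := by
    intro F hF
    have e : ∀ x, (F x - ∫ y, F y ∂ν) ^ 2
        = F x ^ 2 - 2 * (∫ y, F y ∂ν) * F x + (∫ y, F y ∂ν) ^ 2 := fun x => by ring
    simp only [e]
    have hF1 : Integrable F ν := hF.integrable (by norm_num)
    have hI : Integrable (fun x => F x ^ 2 - 2 * (∫ y, F y ∂ν) * F x) ν :=
      hF.integrable_sq.sub (hF1.const_mul _)
    rw [integral_add hI (integrable_const _), integral_sub hF.integrable_sq (hF1.const_mul _),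
      integral_const_mul]
    simp only [integral_const, probReal_univ, one_smul]
    ring
  -- The change of expectation is the covariance of `Φ` and `ρ`; Cauchy–Schwarz reduces it to the
  -- two variances.
  have hcov : ∫ x, (Φ x - m) * (ρ x - 1) ∂ν = ∫ x, Φ x * ρ x ∂ν - m := by
    have e : ∀ x, (Φ x - m) * (ρ x - 1) = Φ x * ρ x - Φ x - (m * ρ x - m) := fun x => by ring
    simp only [e]
    have hI1 : Integrable (fun x => Φ x * ρ x - Φ x) ν := hΦρ.sub hΦi
    have hI2 : Integrable (fun x => m * ρ x - m) ν := (hρint.const_mul m).sub (integrable_const m)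
    rw [integral_sub hI1 hI2,
      integral_sub hΦρ hΦi, integral_sub (hρint.const_mul m) (integrable_const m),
      integral_const_mul, hρi]
    simp only [integral_const, probReal_univ, one_smul]
    ring
  have htilt : ∫ x, Φ x ∂(ν.tilted u) = ∫ x, Φ x * ρ x ∂ν := by
    rw [integral_tilted]
    exact integral_congr_ae (.of_forall fun x => by simp [hρ, hZ, mul_comm])
  have hcs := sq_integral_mul_le (hΦ2.sub (memLp_const m)) (hρ2.sub (memLp_const 1))
  simp only [Pi.sub_apply] at hcs
  have hv1 := hvar hΦ2
  have hv2 := hvar hρ2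
  rw [← hm_def] at hv1
  rw [hρi] at hv2
  rw [hcov, hv1, hv2] at hcs
  have hp1 := h.var_le hC hΦ hΦ2 hΦ'
  have hp2 := h.var_le hC hρ1 hρ2 hρ'm
  rw [hρi] at hp2
  set A := ∫ x, ‖fderiv ℝ Φ x‖ ^ 2 ∂ν with hA_def
  have hA : 0 ≤ A := integral_nonneg fun _ => sq_nonneg _
  have hvp : 0 ≤ ∫ x, ρ x ^ 2 ∂ν - 1 ^ 2 := by
    rw [← hv2]; exact integral_nonneg fun _ => sq_nonneg _
  rw [htilt]
  refine abs_le_of_sq_le_sq ?_ (by positivity)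
  have hs := Real.sq_sqrt hA
  calc (m - ∫ x, Φ x * ρ x ∂ν) ^ 2 = (∫ x, Φ x * ρ x ∂ν - m) ^ 2 := by ring
    _ ≤ _ := hcs
    _ ≤ (2 * C * A) * (2 * C * (L ^ 2 * 4)) := by
      refine mul_le_mul hp1 (hp2.trans ?_) hvp (by positivity)
      gcongr
    _ = (4 * C * L) ^ 2 * A := by ring
    _ = _ := by rw [mul_pow _ (√A), hs]

end Tilt

/-! ### Gibbs measures as tilts. -/

section Gibbs

variable {X : Type*} [MeasureSpace X]

/-- Total mass one excludes the values `0` and `∞` of the normalizing constant. -/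
theorem gibbs_eq_tilted {H : X → ℝ} (hH : Measurable H) [hp : IsProbabilityMeasure (gibbs H)] :
    Integrable (fun x => Real.exp ((-H) x)) (volume : Measure X) ∧
      gibbs H = (volume : Measure X).tilted (-H) := by
  set I := ∫⁻ x : X, ENNReal.ofReal (Real.exp (-H x)) with hI
  have hone : I⁻¹ * I = 1 := by
    have := hp.measure_univ
    rw [gibbs, Measure.smul_apply, withDensity_apply _ MeasurableSet.univ, Measure.restrict_univ,
      smul_eq_mul] at this
    exact this
  have hItop : I ≠ ⊤ := by rintro h; simp [h] at hone
  have hI0 : I ≠ 0 := by rintro h; simp [h] at hone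
  have hint : Integrable (fun x => Real.exp ((-H) x)) (volume : Measure X) := by
    refine ⟨(Real.measurable_exp.comp hH.neg).aestronglyMeasurable, ?_⟩
    rw [hasFiniteIntegral_iff_ofReal (.of_forall fun _ => (Real.exp_pos _).le)]
    exact lt_top_iff_ne_top.2 hItop
  refine ⟨hint, ?_⟩
  have hval : ∫ x, Real.exp ((-H) x) = I.toReal := by
    rw [integral_eq_lintegral_of_nonneg_ae (.of_forall fun _ => (Real.exp_pos _).le) hint.1]
    rfl
  rw [gibbs, Measure.tilted, ← withDensity_smul _ (by fun_prop)]
  congr 1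
  funext x
  rw [hval, ENNReal.ofReal_div_of_pos (ENNReal.toReal_pos hI0 hItop), ENNReal.ofReal_toReal hItop,
    Pi.smul_apply, smul_eq_mul, ENNReal.div_eq_inv_mul]
  rfl

theorem gibbs_tilted {H H' : X → ℝ} (hH : Measurable H) (hH' : Measurable H')
    [IsProbabilityMeasure (gibbs H)] [IsProbabilityMeasure (gibbs H')] :
    gibbs H' = (gibbs H).tilted (fun x => H x - H' x) := by
  rw [(gibbs_eq_tilted hH).2, tilted_tilted (gibbs_eq_tilted hH).1, (gibbs_eq_tilted hH').2]
  congr 1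
  funext x
  simp only [Pi.neg_apply, Pi.add_apply]
  ring

theorem gibbs_map_eq {H : X → ℝ} (R : X ≃ᵐ X) (hR : MeasurePreserving R) (hHR : ∀ x, H (R x) = H x) :
    (gibbs H).map R = gibbs H := by
  rw [gibbs, Measure.map_smul]
  congr 1
  refine Measure.ext fun s hs => ?_
  rw [Measure.map_apply R.measurable hs, withDensity_apply _ hs,
    withDensity_apply _ (R.measurable hs),
    ← hR.setLIntegral_comp_preimage_emb R.measurableEmbedding _ s]
  simp only [hHR]

end Gibbs

/-! ### Dependence of the Hamiltonian on the conditioning. -/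

section Hamiltonian

variable {d : ℕ}

theorem sum_fin_split {N k : ℕ} (h : k + (N - k) = N) (F : Fin N → ℝ) :
    ∑ i, F i = ∑ a : Fin k, F (Fin.cast h (Fin.castAdd (N - k) a))
      + ∑ b : Fin (N - k), F (Fin.cast h (Fin.natAdd k b)) := by
  rw [← (finCongr h).sum_comp, Fin.sum_univ_add]
  rfl

theorem glue_left {N k : ℕ} (h : k + (N - k) = N) (x : Config d k) (y : Config d (N - k))
    (a : Fin k) : glue x y (Fin.cast h (Fin.castAdd (N - k) a)) = x a := by
  simp [glue]

theorem glue_right {N k : ℕ} (h : k + (N - k) = N) (x : Config d k) (y : Config d (N - k))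
    (b : Fin (N - k)) : glue x y (Fin.cast h (Fin.natAdd k b)) = y b := by
  simp [glue]

variable (V W : Pt d → ℝ)

/-- Restoring the diagonal terms, each equal to `W 0`, gives full double sums, which split and
permute freely. -/
theorem hamiltonian_glue {N k : ℕ} (hk : k ≤ N) (x : Config d k) (y : Config d (N - k)) :
    hamiltonian V W N (glue x y) = ∑ a, V (x a) + ∑ b, V (y b)
      + 1 / (2 * ((N : ℝ) - 1)) * (∑ a, ∑ a', W (x a - x a') + ∑ b, ∑ b', W (y b - y b')
        + ∑ b, ∑ a, (W (x a - y b) + W (y b - x a)) - N * W 0) := by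
  have h : k + (N - k) = N := by omega
  have e : ∀ z : Fin N → Pt d, ∑ i, ∑ j ∈ Finset.univ.erase i, W (z i - z j)
      = ∑ i, ∑ j, W (z i - z j) - N * W 0 := by
    intro z
    have : ∀ i, ∑ j ∈ Finset.univ.erase i, W (z i - z j) = ∑ j, W (z i - z j) - W 0 := by
      intro i
      rw [← Finset.sum_erase_add _ _ (Finset.mem_univ i), sub_self, add_sub_cancel_right]
    simp [this]
  rw [hamiltonian, e, sum_fin_split h, sum_fin_split h]
  simp only [sum_fin_split h (fun j => W (_ - glue x y j)), glue_left, glue_right]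
  simp only [Finset.sum_add_distrib]
  rw [Finset.sum_comm (f := fun a b => W (x a - y b))]
  ring

/-- The effect of moving the first particles from `x'` to `x` on the potential felt by one of the
other particles. -/
def forceGap (N : ℕ) {k : ℕ} (x x' : Config d k) (z : Pt d) : ℝ :=
  1 / (2 * ((N : ℝ) - 1)) * ∑ a, ((W (x a - z) - W (x' a - z)) + (W (z - x a) - W (z - x' a)))

/-- Interactions among the remaining particles cancel and those among the first ones are constant;
only the cross terms survive, and they are additive over the remaining particles. -/
theorem hamiltonian_glue_sub {N k : ℕ} (hk : k ≤ N) (x x' : Config d k) :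
    ∃ K : ℝ, ∀ y : Config d (N - k),
      hamiltonian V W N (glue x y) - hamiltonian V W N (glue x' y)
        = K + ∑ b, forceGap W N x x' (y b) := by
  refine ⟨∑ a, V (x a) - ∑ a, V (x' a) + 1 / (2 * ((N : ℝ) - 1)) *
    (∑ a, ∑ a', W (x a - x a') - ∑ a, ∑ a', W (x' a - x' a')), fun y => ?_⟩
  rw [hamiltonian_glue V W hk, hamiltonian_glue V W hk]
  simp only [forceGap, ← Finset.mul_sum, Finset.sum_add_distrib, Finset.sum_sub_distrib]
  ring

variable {V W} {β : ℝ}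

theorem IsSmoothPotential.norm_fderiv_sub_le (hW : IsSmoothPotential W β) (x y : Pt d) :
    ‖fderiv ℝ W x - fderiv ℝ W y‖ ≤ β * ‖x - y‖ := by
  have := hW.2 x y
  rwa [gradient, gradient, ← map_sub, LinearIsometryEquiv.norm_map] at this

theorem IsSmoothPotential.contDiff (hW : IsSmoothPotential W β) : ContDiff ℝ 1 W := by
  refine contDiff_one_iff_fderiv.2 ⟨hW.1, ?_⟩
  refine (LipschitzWith.of_dist_le_mul (K := β.toNNReal) fun x y => ?_).continuous
  rw [dist_eq_norm, dist_eq_norm]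
  refine (hW.norm_fderiv_sub_le x y).trans ?_
  gcongr
  exact Real.le_coe_toNNReal β

theorem contDiff_forceGap (hW : IsSmoothPotential W β) (N : ℕ) {k : ℕ} (x x' : Config d k) :
    ContDiff ℝ 1 (forceGap W N x x') := by
  have := hW.contDiff
  unfold forceGap
  fun_prop

/-- The derivative in `z` is a difference of derivatives of `W` at points `p - q` apart. -/
theorem IsSmoothPotential.abs_gap_le (hW : IsSmoothPotential W β) (p q z z' : Pt d) :
    |(W (p - z) - W (q - z)) - (W (p - z') - W (q - z'))| ≤ β * ‖p - q‖ * ‖z - z'‖ := by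
  have hd : ∀ z, HasFDerivAt (fun z => W (p - z) - W (q - z))
      (-(fderiv ℝ W (p - z) - fderiv ℝ W (q - z))) z := by
    intro z
    have h1 : ∀ p : Pt d, HasFDerivAt (fun z => W (p - z)) (-fderiv ℝ W (p - z)) z := by
      intro p
      have := (hW.1 (p - z)).hasFDerivAt.comp z ((hasFDerivAt_id z).const_sub p)
      refine this.congr_fderiv ?_
      ext v; simp
    refine ((h1 p).sub (h1 q)).congr_fderiv ?_
    ext v; simp; ring
  have := Convex.norm_image_sub_le_of_norm_hasFDerivWithin_le (f := fun z => W (p - z) - W (q - z))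
    (C := β * ‖p - q‖) (s := Set.univ) (x := z') (y := z) (fun z _ => (hd z).hasFDerivWithinAt)
    (fun z _ => ?_) convex_univ trivial trivial
  · exact this
  · rw [norm_neg]
    have := hW.norm_fderiv_sub_le (p - z) (q - z)
    rwa [sub_sub_sub_cancel_right] at this

/-- `W` need not be even; the other orientation follows by reflecting it. -/
theorem IsSmoothPotential.abs_gap_le' (hW : IsSmoothPotential W β) (p q z z' : Pt d) :
    |(W (z - p) - W (z - q)) - (W (z' - p) - W (z' - q))| ≤ β * ‖p - q‖ * ‖z - z'‖ := by
  have hneg : IsSmoothPotential (fun z => W (-z)) β := by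
    have hg : ∀ z, gradient (fun z => W (-z)) z = -gradient W (-z) := by
      intro z
      rw [gradient, gradient, ← map_neg]
      congr 1
      have := (hW.1 (-z)).hasFDerivAt.comp z (hasFDerivAt_id z).neg
      refine (this.congr_fderiv ?_).fderiv
      ext v; simp
    refine ⟨hW.1.comp differentiable_id.neg, fun x y => ?_⟩
    rw [hg, hg, neg_sub_neg, norm_sub_rev]
    refine (hW.2 (-x) (-y)).trans_eq ?_
    rw [neg_sub_neg, norm_sub_rev]
  simpa using hneg.abs_gap_le p q z z'

theorem sum_norm_le (n : ℕ) (y : Config d n) : ∑ b, ‖y b‖ ≤ √n * ‖y‖ := by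
  have h := Real.sum_mul_le_sqrt_mul_sqrt Finset.univ (fun _ : Fin n => (1 : ℝ)) (fun b => ‖y b‖)
  rw [PiLp.norm_eq_of_L2]
  simpa using h

/-- The two orientations cancel the `2` in `1 / (2 (N - 1))`; Cauchy–Schwarz over the `k` moved
particles yields `√k`. -/
theorem abs_forceGap_sub_le (hW : IsSmoothPotential W β) (hβ : 0 ≤ β) {N : ℕ} (hN : 2 ≤ N) {k : ℕ}
    (x x' : Config d k) (z z' : Pt d) :
    |forceGap W N x x' z - forceGap W N x x' z'|
      ≤ β * (√k * ‖x - x'‖) / (N - 1) * ‖z - z'‖ := by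
  have hN1 : (0 : ℝ) < N - 1 := by
    have : (2 : ℝ) ≤ N := by exact_mod_cast hN
    linarith
  rw [forceGap, forceGap, ← mul_sub, ← Finset.sum_sub_distrib, abs_mul,
    abs_of_pos (by positivity : 0 < 1 / (2 * ((N : ℝ) - 1)))]
  have h1 : |∑ a, (((W (x a - z) - W (x' a - z)) + (W (z - x a) - W (z - x' a)))
      - ((W (x a - z') - W (x' a - z')) + (W (z' - x a) - W (z' - x' a))))|
      ≤ ∑ a, 2 * β * ‖z - z'‖ * ‖(x - x') a‖ := by
    refine (Finset.abs_sum_le_sum_abs _ _).trans (Finset.sum_le_sum fun a _ => ?_)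
    have h2 := hW.abs_gap_le (x a) (x' a) z z'
    have h3 := hW.abs_gap_le' (x a) (x' a) z z'
    rw [add_sub_add_comm]
    refine (abs_add_le _ _).trans ((add_le_add h2 h3).trans_eq ?_)
    rw [PiLp.sub_apply]
    ring
  rw [← Finset.mul_sum] at h1
  have h4 := sum_norm_le k (x - x')
  calc _ ≤ 1 / (2 * ((N : ℝ) - 1)) * (2 * β * ‖z - z'‖ * (√k * ‖x - x'‖)) := by
        gcongr
        refine h1.trans ?_
        gcongr
    _ = _ := by field_simp

end Hamiltonian

/-! ### Integrability from exponential moments. -/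

section ExpMoments

variable {X : Type*} [NormedAddCommGroup X] [MeasurableSpace X] [BorelSpace X] {ν : Measure X}

omit [BorelSpace X] in
-- The square has degree four, so the fourth term of the exponential series dominates it.
theorem memLp_of_norm_le_quadratic {E : Type*} [NormedAddCommGroup E] {l : ℝ} (hl0 : 0 < l)
    (hl : Integrable (fun x => Real.exp (l * ‖x‖)) ν) {Φ : X → E}
    (hΦ : AEStronglyMeasurable Φ ν) {A : ℝ} (hA : ∀ x, ‖Φ x‖ ≤ A * (1 + ‖x‖) ^ 2) :
    MemLp Φ 2 ν := by
  rw [memLp_two_iff_integrable_sq_norm hΦ]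
  refine (hl.const_mul (A ^ 2 * (24 / l ^ 4 * Real.exp l))).mono' (hΦ.norm.pow 2)
    (.of_forall fun x => ?_)
  have h1 := Real.pow_div_factorial_le_exp (l * (1 + ‖x‖)) (by positivity) 4
  have h2 : (1 + ‖x‖) ^ 4 ≤ 24 / l ^ 4 * Real.exp (l * (1 + ‖x‖)) := by
    rw [div_mul_eq_mul_div, le_div_iff₀ (by positivity)]
    rw [mul_pow, div_le_iff₀ (by positivity)] at h1
    have : ((Nat.factorial 4 : ℕ) : ℝ) = 24 := by norm_num [Nat.factorial]
    rw [this] at h1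
    linarith
  calc ‖‖Φ x‖ ^ 2‖ = ‖Φ x‖ ^ 2 := Real.norm_of_nonneg (sq_nonneg _)
    _ ≤ (A * (1 + ‖x‖) ^ 2) ^ 2 := by
      have := hA x
      gcongr
    _ = A ^ 2 * (1 + ‖x‖) ^ 4 := by ring
    _ ≤ A ^ 2 * (24 / l ^ 4 * Real.exp (l * (1 + ‖x‖))) := by gcongr
    _ = _ := by
      rw [mul_add, mul_one, Real.exp_add]; ring

theorem memLp_id_of_exp {l : ℝ} [SecondCountableTopology X] (hl0 : 0 < l)
    (hl : Integrable (fun x => Real.exp (l * ‖x‖)) ν) : MemLp id 2 ν :=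
  memLp_of_norm_le_quadratic hl0 hl aestronglyMeasurable_id (A := 1) fun x => by
    simp only [id]
    nlinarith [norm_nonneg x]

omit [BorelSpace X] in
theorem lintegral_enorm_sq_ne_top (hν : MemLp id 2 ν) : ∫⁻ x, ‖x‖ₑ ^ (2 : ℝ) ∂ν ≠ ⊤ := by
  have := lintegral_rpow_enorm_lt_top_of_eLpNorm_lt_top (by norm_num) (by norm_num) hν.2
  simpa using this.ne

end ExpMoments

/-! ### Gradients of additive functions. -/

section Additive

/-- `hP` is a Bessel inequality: with it, Cauchy–Schwarz bounds the squared gradient by the sum of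
the squares, without a factor counting the summands. -/
theorem norm_fderiv_sum_comp_sq_le {ι X Y : Type*} [Fintype ι] [NormedAddCommGroup X]
    [NormedSpace ℝ X] [NormedAddCommGroup Y] [NormedSpace ℝ Y] {P : ι → X →L[ℝ] Y}
    (hP : ∀ v, ∑ j, ‖P j v‖ ^ 2 ≤ ‖v‖ ^ 2) {f : Y → ℝ} (hf : Differentiable ℝ f) (y : X) :
    ‖fderiv ℝ (fun y => ∑ j, f (P j y)) y‖ ^ 2 ≤ ∑ j, ‖fderiv ℝ f (P j y)‖ ^ 2 := by
  have h1 : HasFDerivAt (fun y => ∑ j, f (P j y)) (∑ j, (fderiv ℝ f (P j y)).comp (P j)) y :=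
    HasFDerivAt.fun_sum fun j _ => ((hf (P j y)).hasFDerivAt).comp y (P j).hasFDerivAt
  rw [h1.fderiv]
  refine (Real.le_sqrt (norm_nonneg _) (Finset.sum_nonneg fun _ _ => sq_nonneg _)).1
    (ContinuousLinearMap.opNorm_le_bound _ (Real.sqrt_nonneg _) fun v => ?_)
  rw [sum_apply]
  refine (norm_sum_le _ _).trans ((Finset.sum_le_sum fun j _ =>
    (fderiv ℝ f (P j y)).le_opNorm (P j v)).trans
    ((Real.sum_mul_le_sqrt_mul_sqrt _ _ _).trans ?_))
  gcongr
  exact Real.sqrt_le_iff.2 ⟨norm_nonneg _, hP v⟩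

variable {d n : ℕ} {f : Pt d → ℝ}

theorem norm_apply_le (y : Config d n) (j : Fin n) : ‖y j‖ ≤ ‖y‖ := PiLp.norm_apply_le y j

/-- The position of the `j`-th particle. -/
def position (j : Fin n) : Config d n →L[ℝ] Pt d := PiLp.proj 2 (fun _ : Fin n => Pt d) j

theorem contDiff_sum_apply (hf : ContDiff ℝ 1 f) :
    ContDiff ℝ 1 (fun y : Config d n => ∑ j, f (y j)) :=
  ContDiff.sum fun j _ => hf.comp (position j : Config d n →L[ℝ] Pt d).contDiff

theorem norm_fderiv_sum_apply_sq_le (hf : ContDiff ℝ 1 f) (y : Config d n) :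
    ‖fderiv ℝ (fun y : Config d n => ∑ j, f (y j)) y‖ ^ 2 ≤ ∑ j, ‖fderiv ℝ f (y j)‖ ^ 2 :=
  norm_fderiv_sum_comp_sq_le (P := fun j => position j)
    (fun v => (PiLp.norm_sq_eq_of_L2 _ v).ge) (hf.differentiable one_ne_zero) y

end Additive

/-! ### Exchangeability of the remaining particles. -/

section Exchangeability

variable {d : ℕ} {V W : Pt d → ℝ} {N k : ℕ}

/-- The law of all the remaining particles given the first `k` ones. -/
def restLaw (V W : Pt d → ℝ) (N k : ℕ) (x : Config d k) : Measure (Config d (N - k)) :=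
  gibbs (fun y : Config d (N - k) => hamiltonian V W N (glue x y))

theorem continuous_hamiltonian_glue (hV : Continuous V) (hW : Continuous W) (hk : k ≤ N)
    (x : Config d k) :
    Continuous (fun y : Config d (N - k) => hamiltonian V W N (glue x y)) := by
  simp only [hamiltonian_glue V W hk]
  fun_prop

/-- Swapping two remaining particles is a linear isometry preserving Lebesgue measure and the glued
Hamiltonian. -/
theorem restLaw_map_apply (hk : k ≤ N) (x : Config d k) (i j : Fin (N - k)) :
    (restLaw V W N k x).map (fun y => y j) = (restLaw V W N k x).map (fun y => y i) := by
  set σ : Equiv.Perm (Fin (N - k)) := Equiv.swap i j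
  let R := LinearIsometryEquiv.piLpCongrLeft 2 ℝ (Pt d) σ
  have hRa : ∀ (y : Config d (N - k)) b, R y b = y (σ.symm b) := fun y b => rfl
  have hH : ∀ y, hamiltonian V W N (glue x (R y)) = hamiltonian V W N (glue x y) := by
    intro y
    rw [hamiltonian_glue V W hk, hamiltonian_glue V W hk]
    simp only [hRa]
    rw [Equiv.sum_comp σ.symm (fun b => V (y b)),
      Equiv.sum_comp σ.symm (fun b => ∑ a, (W (x a - y b) + W (y b - x a))),
      Equiv.sum_comp σ.symm (fun b => ∑ b', W (y b - y (σ.symm b')))]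
    simp only [fun b => Equiv.sum_comp σ.symm (fun b' => W (y b - y b'))]
  have hmap := gibbs_map_eq (H := fun y => hamiltonian V W N (glue x y)) R.toMeasurableEquiv
    R.measurePreserving hH
  conv_rhs => rw [restLaw, ← hmap]
  rw [Measure.map_map (by fun_prop) R.toMeasurableEquiv.measurable]
  congr 1
  funext y
  change y j = R y i
  rw [hRa, Equiv.symm_swap, Equiv.swap_apply_left]

theorem measurable_firstParticles {n m : ℕ} (h : m ≤ n) :
    Measurable (firstParticles (d := d) h) := by
  unfold firstParticles
  fun_prop

theorem condLaw_self (hk : N - k ≤ N - k) (x : Config d k) :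
    condLaw V W N k (N - k) hk x = restLaw V W N k x := by
  have : firstParticles (d := d) hk = id := by
    funext y
    ext i
    rfl
  rw [condLaw, this, Measure.map_id, restLaw]

theorem nextLaw_eq (hkN : k < N) (x : Config d k) (j : Fin (N - k)) :
    nextLaw V W N k hkN x = (restLaw V W N k x).map (fun y => y j) := by
  rw [nextLaw, condLaw, Measure.map_map (by fun_prop) (measurable_firstParticles _),
    restLaw_map_apply hkN.le x (Fin.castLE (Nat.sub_pos_of_lt hkN) 0) j]
  rfl

theorem isProbabilityMeasure_nextLaw (hkN : k < N) {x : Config d k}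
    (h : IsProbabilityMeasure (restLaw V W N k x)) :
    IsProbabilityMeasure (nextLaw V W N k hkN x) := by
  rw [nextLaw_eq hkN x ⟨0, Nat.sub_pos_of_lt hkN⟩]
  exact Measure.isProbabilityMeasure_map (Measurable.aemeasurable (by fun_prop))

theorem integral_nextLaw (hkN : k < N) (x : Config d k) (j : Fin (N - k)) {f : Pt d → ℝ}
    (hf : Continuous f) :
    ∫ z, f z ∂(nextLaw V W N k hkN x) = ∫ y, f (y j) ∂(restLaw V W N k x) := by
  rw [nextLaw_eq hkN x j, integral_map (Measurable.aemeasurable (by fun_prop))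
    hf.aestronglyMeasurable]

theorem memLp_nextLaw (hkN : k < N) (x : Config d k) (h : MemLp id 2 (restLaw V W N k x)) :
    MemLp id 2 (nextLaw V W N k hkN x) := by
  rw [nextLaw_eq hkN x ⟨0, Nat.sub_pos_of_lt hkN⟩,
    memLp_map_measure_iff aestronglyMeasurable_id (Measurable.aemeasurable (by fun_prop))]
  exact h.mono (Measurable.aestronglyMeasurable (by fun_prop))
    (.of_forall fun y => norm_apply_le y _)

theorem integral_sum_restLaw (hkN : k < N) (x : Config d k) {f : Pt d → ℝ}
    (hf : Continuous f) (hi : ∀ j, Integrable (fun y => f (y j)) (restLaw V W N k x)) :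
    ∫ y, ∑ j, f (y j) ∂(restLaw V W N k x)
      = (N - k : ℕ) * ∫ z, f z ∂(nextLaw V W N k hkN x) := by
  rw [integral_finsetSum _ fun j _ => hi j]
  simp only [← integral_nextLaw hkN x _ hf]
  simp

end Exchangeability

/-! ### Local and global Lipschitz estimates. -/

section Recursion

variable {d : ℕ} {V W : Pt d → ℝ} {N k : ℕ} {β C : ℝ}

/-- The one-particle conditional laws depend on the conditioning in a locally Lipschitz way. -/
theorem exists_W2_nextLaw_le (hV : Continuous V) (hβ : 0 ≤ β) (hC : 0 < C)
    (hW : IsSmoothPotential W β) (hN : 2 ≤ N) (hkN : k < N)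
    (hLS : ∀ x : Config d k, LogSobolev (restLaw V W N k x) C) (x : Config d k) :
    ∃ ε > 0, ∀ x' : Config d k, ‖x - x'‖ < ε →
      W2 (nextLaw V W N k hkN x') (nextLaw V W N k hkN x)
        ≤ ENNReal.ofReal (12 * (β * C) * (√k * ‖x - x'‖) / (N - 1)) := by
  have hWc := hW.contDiff.continuous
  have hpr : ∀ x : Config d k, IsProbabilityMeasure (restLaw V W N k x) :=
    fun x => (hLS x).isProbabilityMeasure
  obtain ⟨l, hl0, hl⟩ := (hLS x).exists_integrable_exp hC
  set n := N - k with hn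
  have hn0 : 0 < n := Nat.sub_pos_of_lt hkN
  have hN1 : (0 : ℝ) < N - 1 := by
    have : (2 : ℝ) ≤ N := by exact_mod_cast hN
    linarith
  set Λ := ∫ y, Real.exp (l * ‖y‖) ∂(restLaw V W N k x)
  have hΛ : 0 ≤ Λ := integral_nonneg fun _ => (Real.exp_pos _).le
  set M := 4 * (√n * (β * √k / (N - 1))) * Λ with hM
  have hM0 : 0 ≤ M := by positivity
  -- Within this radius `4 (√n G) Λ = M ‖x - x'‖ ≤ l`, as the tilt estimate requires. The radius
  -- depends on `x` through `l` and `Λ`; the final constant does not.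
  refine ⟨l / (M + 1), by positivity, fun x' hx' => ?_⟩
  set G := β * (√k * ‖x - x'‖) / (N - 1) with hG
  have hG0 : 0 ≤ G := by positivity
  have hL : 4 * (√n * G) * Λ ≤ l := by
    rw [lt_div_iff₀ (by positivity)] at hx'
    have : 4 * (√n * G) * Λ = M * ‖x - x'‖ := by
      rw [hM, hG]; field_simp
    rw [this]
    nlinarith [norm_nonneg (x - x')]
  obtain ⟨l', hl0', hl'⟩ := (hLS x').exists_integrable_exp hC
  have hm := memLp_id_of_exp hl0 hl
  have hm' := memLp_id_of_exp hl0' hl'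
  have := isProbabilityMeasure_nextLaw hkN (hpr x)
  have := isProbabilityMeasure_nextLaw hkN (hpr x')
  have hbound := W2_le_of_weak_bound (nextLaw V W N k hkN x') (nextLaw V W N k hkN x)
    (memLp_nextLaw hkN x' hm') (memLp_nextLaw hkN x hm) (D := 4 * C * G) (by positivity) ?_
  · refine hbound.trans_eq ?_
    congr 1
    rw [hG]; ring
  rintro f hf ⟨A, hA⟩ ⟨A', hA'⟩
  obtain ⟨K, hK⟩ := hamiltonian_glue_sub V W hkN.le x x'
  have hA0 : 0 ≤ A := by simpa using (abs_nonneg _).trans (hA 0)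
  have hA0' : 0 ≤ A' := by simpa using (norm_nonneg _).trans (hA' 0)
  have hfj : ∀ {ν : Measure (Config d n)} {l : ℝ}, 0 < l →
      Integrable (fun x => Real.exp (l * ‖x‖)) ν → ∀ j, MemLp (fun y => f (y j)) 2 ν := by
    intro ν l hl0 hl j
    refine memLp_of_norm_le_quadratic hl0 hl
      (hf.continuous.comp (by fun_prop)).aestronglyMeasurable (A := A) fun y => ?_
    refine (hA (y j)).trans ?_
    have := norm_apply_le y j
    gcongr
  have hf'c := hf.continuous_fderiv one_ne_zero
  have hf'j : ∀ j, MemLp (fun y : Config d n => ‖fderiv ℝ f (y j)‖) 2 (restLaw V W N k x) := by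
    intro j
    refine memLp_of_norm_le_quadratic hl0 hl
      (hf'c.norm.comp (by fun_prop)).aestronglyMeasurable (A := A') fun y => ?_
    rw [norm_norm]
    refine (hA' (y j)).trans ?_
    have := norm_apply_le y j
    gcongr
    nlinarith [norm_nonneg y, norm_nonneg (y j)]
  set u : Config d n → ℝ := fun y =>
    hamiltonian V W N (glue x y) - hamiltonian V W N (glue x' y) with hu_def
  have hu_eq : u = fun y => K + ∑ b, forceGap W N x x' (y b) := funext hK
  have hu : ContDiff ℝ 1 u := by
    rw [hu_eq]
    exact contDiff_const.add (contDiff_sum_apply (contDiff_forceGap hW N x x'))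
  have huL : ∀ y y', |u y - u y'| ≤ √n * G * ‖y - y'‖ := by
    intro y y'
    rw [hu_eq]
    have e : K + ∑ b, forceGap W N x x' (y b) - (K + ∑ b, forceGap W N x x' (y' b))
        = ∑ b, (forceGap W N x x' (y b) - forceGap W N x x' (y' b)) := by
      rw [Finset.sum_sub_distrib]; ring
    simp only [e]
    refine (Finset.abs_sum_le_sum_abs _ _).trans ?_
    calc ∑ b, |forceGap W N x x' (y b) - forceGap W N x x' (y' b)|
        ≤ ∑ b, G * ‖(y - y') b‖ :=
          Finset.sum_le_sum fun b _ => abs_forceGap_sub_le hW hβ hN x x' _ _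
      _ = G * ∑ b, ‖(y - y') b‖ := by rw [Finset.mul_sum]
      _ ≤ G * (√n * ‖y - y'‖) := by
          gcongr; exact sum_norm_le n (y - y')
      _ = _ := by ring
  have htilt : restLaw V W N k x' = (restLaw V W N k x).tilted u := by
    have h1 : IsProbabilityMeasure
      (gibbs (fun y : Config d (N - k) => hamiltonian V W N (glue x y))) := hpr x
    have h2 : IsProbabilityMeasure
      (gibbs (fun y : Config d (N - k) => hamiltonian V W N (glue x' y))) := hpr x'
    exact gibbs_tilted (continuous_hamiltonian_glue hV hWc hkN.le x).measurable
      (continuous_hamiltonian_glue hV hWc hkN.le x').measurable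
  set Φ : Config d n → ℝ := fun y => ∑ j, f (y j) with hΦ_def
  have hΦ : ContDiff ℝ 1 Φ := contDiff_sum_apply hf
  have hΦ2 : MemLp Φ 2 (restLaw V W N k x) := memLp_finsetSum _ fun j _ => hfj hl0 hl j
  have hΦ'le := norm_fderiv_sum_apply_sq_le (n := n) hf
  have hsumI : Integrable (fun y : Config d n => ∑ j, ‖fderiv ℝ f (y j)‖ ^ 2)
      (restLaw V W N k x) := integrable_finsetSum _ fun j _ => (hf'j j).integrable_sq
  have hΦ'm : AEStronglyMeasurable (fun y => ‖fderiv ℝ Φ y‖) (restLaw V W N k x) :=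
    (hΦ.continuous_fderiv one_ne_zero).norm.aestronglyMeasurable
  have hΦ'2 : MemLp (fun y => ‖fderiv ℝ Φ y‖) 2 (restLaw V W N k x) := by
    refine (memLp_two_iff_integrable_sq hΦ'm).2 (hsumI.mono' (hΦ'm.pow 2) (.of_forall fun y => ?_))
    rw [Real.norm_of_nonneg (sq_nonneg _)]
    exact hΦ'le y
  have hmain := (hLS x).abs_integral_sub_tilted_le hC.le hu hl0 (by positivity) hl hL huL hΦ hΦ2
    hΦ'2
  rw [← htilt, integral_sum_restLaw hkN x hf.continuous
      fun j => (hfj hl0 hl j).integrable (by norm_num),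
    integral_sum_restLaw hkN x' hf.continuous
      fun j => (hfj hl0' hl' j).integrable (by norm_num), ← mul_sub, abs_mul,
    Nat.abs_cast] at hmain
  have hgrad : ∫ y, ‖fderiv ℝ Φ y‖ ^ 2 ∂(restLaw V W N k x)
      ≤ n * ∫ z, ‖fderiv ℝ f z‖ ^ 2 ∂(nextLaw V W N k hkN x) := by
    have := integral_sum_restLaw hkN x (f := fun z => ‖fderiv ℝ f z‖ ^ 2) (hf'c.norm.pow 2)
      fun j => (hf'j j).integrable_sq
    refine le_of_le_of_eq ?_ this
    exact integral_mono hΦ'2.integrable_sq hsumI hΦ'le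
  have hsq := Real.sqrt_le_sqrt hgrad
  rw [Real.sqrt_mul n.cast_nonneg] at hsq
  set S := √(∫ z, ‖fderiv ℝ f z‖ ^ 2 ∂(nextLaw V W N k hkN x))
  set I := ∫ z, f z ∂(nextLaw V W N k hkN x) - ∫ z, f z ∂(nextLaw V W N k hkN x')
  have hnpos : (0 : ℝ) < n := by exact_mod_cast hn0
  -- One `√n` comes from the Lipschitz constant of `u`, the other from the gradient of `Φ`; together
  -- they match the `n` on the left.
  have h3 : n * |I| ≤ n * (4 * C * G * S) := by
    calc n * |I| ≤ _ := hmain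
      _ ≤ 4 * C * (√n * G) * (√n * S) := by gcongr
      _ = (√n * √n) * (4 * C * G * S) := by ring
      _ = n * (4 * C * G * S) := by rw [Real.mul_self_sqrt n.cast_nonneg]
  exact (le_abs_self I).trans (le_of_mul_le_mul_left h3 hnpos)

/-- A locally Lipschitz function on the line, with a uniform constant, is Lipschitz. -/
theorem abs_sub_le_of_locally {φ : ℝ → ℝ} {M : ℝ}
    (h : ∀ s, ∃ ε > 0, ∀ t, |t - s| < ε → |φ t - φ s| ≤ M * |t - s|) {a b : ℝ} (hab : a ≤ b) :
    |φ b - φ a| ≤ M * (b - a) := by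
  have hc : Continuous φ := by
    refine continuous_iff_continuousAt.2 fun s => ?_
    obtain ⟨ε, hε, hs⟩ := h s
    rw [ContinuousAt, tendsto_iff_dist_tendsto_zero]
    have h1 : Filter.Tendsto (fun t => M * |t - s|) (nhds s) (nhds 0) := by
      have : Continuous (fun t => M * |t - s|) := by fun_prop
      simpa using this.tendsto s
    refine squeeze_zero' (.of_forall fun _ => dist_nonneg) ?_ h1
    filter_upwards [Metric.ball_mem_nhds s hε] with t ht
    exact hs t ht
  -- Continuous induction: the set is closed by continuity of `φ`, contains `a`, and extends to the
  -- right of each of its points.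
  have hsub : Set.Icc a b ⊆ {t | |φ t - φ a| ≤ M * (t - a)} := by
    refine IsClosed.Icc_subset_of_forall_exists_gt ?_ (by simp) fun s hs y hy => ?_
    · exact (isClosed_le (by fun_prop) (by fun_prop)).inter isClosed_Icc
    · obtain ⟨ε, hε, hsε⟩ := h s
      have hy' : s < y := hy
      refine ⟨min y (s + ε / 2), ?_, ?_⟩
      · have h1 : s < min y (s + ε / 2) := lt_min hy' (by linarith)
        have h2 : min y (s + ε / 2) ≤ s + ε / 2 := min_le_right _ _
        have h3 := hsε (min y (s + ε / 2)) (by rw [abs_of_pos (by linarith)]; linarith)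
        have h4 : |φ s - φ a| ≤ M * (s - a) := hs.1
        rw [abs_of_pos (by linarith : 0 < min y (s + ε / 2) - s)] at h3
        change |φ (min y (s + ε / 2)) - φ a| ≤ M * (min y (s + ε / 2) - a)
        calc _ ≤ |φ (min y (s + ε / 2)) - φ s| + |φ s - φ a| := abs_sub_le _ _ _
          _ ≤ _ := by linarith
      · exact ⟨lt_min hy' (by linarith), min_le_left _ _⟩
  exact hsub ⟨hab, le_rfl⟩

/-- The conditional hypothesis is used for the block of all `N - k` remaining particles. -/
theorem StrongIsoperimetry.logSobolev_restLaw {π : Measure (Pt d)}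
    (h : StrongIsoperimetry V W N C π) (hk : 1 ≤ k) (hkN : k < N) (x : Config d k) :
    LogSobolev (restLaw V W N k x) C := by
  have := h.conditional k (N - k) hk (by omega) (by omega) le_rfl x
  rwa [condLaw_self] at this

/-- The Wasserstein distance from the one-particle conditional law to a fixed measure is a
Lipschitz function of the conditioning. -/
theorem abs_W2_nextLaw_sub_le (hV : Continuous V) (hβ : 0 ≤ β) (hC : 0 < C)
    (hW : IsSmoothPotential W β) (hN : 2 ≤ N) (hkN : k < N)
    (hLS : ∀ x : Config d k, LogSobolev (restLaw V W N k x) C) {π : Measure (Pt d)}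
    (hπ : LogSobolev π C) (x x' : Config d k) :
    W2 (nextLaw V W N k hkN x) π ≠ ⊤ ∧
      |(W2 (nextLaw V W N k hkN x) π).toReal - (W2 (nextLaw V W N k hkN x') π).toReal|
        ≤ 12 * (β * C) * (√k * ‖x - x'‖) / (N - 1) := by
  have := hπ.isProbabilityMeasure
  have hpr : ∀ x, IsProbabilityMeasure (nextLaw V W N k hkN x) := fun x =>
    isProbabilityMeasure_nextLaw hkN (hLS x).isProbabilityMeasure
  obtain ⟨l, hl0, hl⟩ := hπ.exists_integrable_exp hC
  have hm := memLp_id_of_exp hl0 hl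
  have htop : ∀ x, W2 (nextLaw V W N k hkN x) π ≠ ⊤ := by
    intro x
    obtain ⟨l', hl0', hl'⟩ := (hLS x).exists_integrable_exp hC
    exact W2_ne_top _ _
      (lintegral_enorm_sq_ne_top (memLp_nextLaw hkN x (memLp_id_of_exp hl0' hl')))
      (lintegral_enorm_sq_ne_top hm)
  refine ⟨htop x, ?_⟩
  have hN1 : (0 : ℝ) < N - 1 := by
    have : (2 : ℝ) ≤ N := by exact_mod_cast hN
    linarith
  have htri : ∀ y y' : Config d k, ∀ c : ℝ, 0 ≤ c →
      W2 (nextLaw V W N k hkN y) (nextLaw V W N k hkN y') ≤ ENNReal.ofReal c →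
      (W2 (nextLaw V W N k hkN y) π).toReal ≤ c + (W2 (nextLaw V W N k hkN y') π).toReal := by
    intro y y' c hc hle
    rw [← ENNReal.toReal_ofReal hc, ← ENNReal.toReal_add ENNReal.ofReal_ne_top (htop y')]
    refine ENNReal.toReal_mono (ENNReal.add_ne_top.2 ⟨ENNReal.ofReal_ne_top, htop y'⟩) ?_
    exact (W2_triangle _ (nextLaw V W N k hkN y') _).trans (by gcongr)
  set γ : ℝ → Config d k := fun s => x' + s • (x - x') with hγ
  set φ : ℝ → ℝ := fun s => (W2 (nextLaw V W N k hkN (γ s)) π).toReal with hφ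
  have hγd : ∀ s t, ‖γ s - γ t‖ = |t - s| * ‖x - x'‖ := by
    intro s t
    have : γ s - γ t = (s - t) • (x - x') := by simp [hγ, sub_smul]
    rw [this, norm_smul, Real.norm_eq_abs, abs_sub_comm]
  set M := 12 * (β * C) * (√k * ‖x - x'‖) / ((N : ℝ) - 1) with hM
  have hM0 : 0 ≤ M := by positivity
  have hloc : ∀ s, ∃ ε > 0, ∀ t, |t - s| < ε → |φ t - φ s| ≤ M * |t - s| := by
    intro s
    obtain ⟨ε, hε, h⟩ := exists_W2_nextLaw_le hV hβ hC hW hN hkN hLS (γ s)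
    -- The `+ 1` covers the case `x = x'`.
    refine ⟨ε / (‖x - x'‖ + 1), by positivity, fun t ht => ?_⟩
    have h1 : ‖γ s - γ t‖ < ε := by
      rw [hγd]
      rw [lt_div_iff₀ (by positivity)] at ht
      nlinarith [abs_nonneg (t - s)]
    have h2 := h (γ t) h1
    have e : 12 * (β * C) * (√k * ‖γ s - γ t‖) / ((N : ℝ) - 1) = M * |t - s| := by
      rw [hγd, hM]; ring
    rw [e] at h2
    have h3 := htri _ _ _ (by positivity) h2
    rw [W2_comm] at h2
    have h4 := htri _ _ _ (by positivity) h2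
    rw [abs_le]
    constructor <;> simp only [hφ] <;> linarith
  have := abs_sub_le_of_locally hloc zero_le_one
  simpa [hφ, hγ] using this

end Recursion

end PropChaos

end

/-! ### The theorem. -/

theorem mainTheorem3 :
    ∃ c δ K : ℝ, 0 < c ∧ 0 < δ ∧ 0 < K ∧
      ∀ (d N k : ℕ) (_hN : 100 ≤ N) (_hk : 1 ≤ k) (hkN : k < N) (_hkδ : (k : ℝ) ≤ δ * N)
        (V W : PropChaos.Pt d → ℝ) (β C : ℝ) (π : MeasureTheory.Measure (PropChaos.Pt d)),
        Differentiable ℝ V →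
        0 ≤ β → 0 < C →
        PropChaos.IsSmoothPotential W β →
        PropChaos.StrongIsoperimetry V W N C π →
        β * C ≤ c →
        ∀ x x' : PropChaos.Config d k,
          PropChaos.W2 (PropChaos.nextLaw V W N k hkN x) π ≠ ⊤ ∧
          PropChaos.W2 (PropChaos.nextLaw V W N k hkN x') π ≠ ⊤ ∧
          |(PropChaos.W2 (PropChaos.nextLaw V W N k hkN x) π).toReal
              - (PropChaos.W2 (PropChaos.nextLaw V W N k hkN x') π).toReal|
            ≤ K * (Real.sqrt k * ‖x - x'‖ / N) := by
  -- `24` is `12 β C` with `β C ≤ 1`, doubled because `N - 1 ≥ N / 2`.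
  refine ⟨1, 1, 24, one_pos, one_pos, by norm_num, ?_⟩
  intro d N k hN hk hkN _ V W β C π hV hβ hC hW hSI hβC x x'
  have hLS := hSI.logSobolev_restLaw hk hkN
  have key := PropChaos.abs_W2_nextLaw_sub_le hV.continuous hβ hC hW (by omega) hkN hLS
    hSI.meanField
  refine ⟨(key x x').1, (key x' x).1, (key x x').2.trans ?_⟩
  have hN' : (100 : ℝ) ≤ N := by exact_mod_cast hN
  have ht : 0 ≤ Real.sqrt k * ‖x - x'‖ := by positivity
  calc 12 * (β * C) * (Real.sqrt k * ‖x - x'‖) / ((N : ℝ) - 1)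
      ≤ 12 * 1 * (Real.sqrt k * ‖x - x'‖) / ((N : ℝ) / 2) := by
        gcongr
        linarith
    _ = 24 * (Real.sqrt k * ‖x - x'‖ / N) := by field_simp; ring
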